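/- Let $R$ be a complete admissible ring with exactly three minimal primes $\wp_1,\wp_2,\wp_3$; that is, $R$ is a one-dimensional noetherian local Cohen–Macaulay ring, complete for the topology of its maximal ideal $\mathfrak m$, analytically reduced, residually rational (for $\widetilde R$ the integral closure of $R$ in its total ring of fractions $K$, the map $R/\mathfrak m\to\widetilde R/\mathfrak n$ is an isomorphism for every maximal ideal $\mathfrak n$ of $\widetilde R$), and the cardinality of $R/\mathfrak m$ is at least the number of minimal primes of $R$. Put $I=\{1,2,3\}$. For nonempty $J\subseteq I$ let $R_J=R/\bigcap_{j\in J}\wp_j$, let $K_J$ be its total ring of fractions and $\pi_J\colon K\to K_J$ the natural projection; write $\pi_i=\pi_{\{i\}}$, and let $v_i$ be the normalized discrete valuation of the field $K_i=K_{\{i\}}$ whose valuation ring is the integral closure of $R/\wp_i$. Write $Z(\cdot)$ for the set of zero divisors. A regular fractional ideal of $R$ is an $R$-submodule $\mathcal I$ of $K$ that contains a regular element of $R$ and satisfies $d\,\mathcal I\subseteq R$ for some regular $d\in R$. Its value set is $E=\{(v_1(\pi_1(h)),v_2(\pi_2(h)),v_3(\pi_3(h))) : h\in\mathcal I\setminus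 Z(K)\}\subset\mathbb Z^3$, and for nonempty $J\subseteq I$ one sets $E_J=\{(v_j(\pi_j(h)))_{j\in J} : h\in\mathcal I,\ \pi_J(h)\notin Z(K_J)\}\subset\mathbb Z^J$ and $E_i=E_{\{i\}}\subset\mathbb Z$. Let $\mathcal L(E_i)$ be the set of integers greater than $\min E_i$ that are not in $E_i$. For a finite index set $T$, a set $A\subseteq\mathbb Z^T$, $\alpha\in\mathbb Z^T$ and nonempty $J\subseteq T$ let $F_J(A,\alpha)=\{\beta\in A : \beta_j=\alpha_j \text{ for } j\in J,\ \beta_k>\alpha_k \text{ for } k\in T\setminus J\}$. A point $\alpha\in A$ is a maximal of $A$ if $F_{\{i\}}(A,\alpha)=\emptyset$ for all $i\in T$. A maximal $\alpha$ is a relative maximal if $F_J(A,\alpha)\ne\emptyset$ for all $J\subseteq T$ with $\#J\ge2$, and an absolute maximal if $F_J(A,\alpha)=\emptyset$ for all nonempty $J\subsetneq T$. Let $M(A)$, $RM(A)$, $AM(A)$ be the sets of maximals, relative maximals and absolute maximals of $A$. Let $\mathcal J\subseteq\mathcal I$ be two regular fractional ideals of $R$, with value sets $D$ and $E$ respectively.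 Then $E$ and $D$ have minima $\alpha^0=\min E$ and $\beta^0=\min D$ for the product order; the sets $\mathcal L(E_i)$, $\mathcal L(D_i)$, $M(E_{\{i,j\}})$, $M(D_{\{i,j\}})$, $M(E)$, $M(D)$ are finite; and the $R$-module $\mathcal I/\mathcal J$ has finite length $$\ell_R(\mathcal I/\mathcal J)=\sum_{i=1}^3\big((\beta^0_i-\alpha^0_i)+(\#\mathcal L(D_i)-\#\mathcal L(E_i))\big)+\sum_{1\le i<j\le3}\#M(D_{\{i,j\}})-\sum_{1\le i<j\le3}\#M(E_{\{i,j\}})+\#RM(D)-\#RM(E)+\#AM(E)-\#AM(D).$$ -/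

import Mathlib

open scoped nonZeroDivisors

namespace AdmissibleRing

universe u

/-! ### Complete admissible rings -/

/-- A Noetherian local ring is Cohen-Macaulay if its maximal ideal contains a regular sequence
whose length is the Krull dimension of the ring. -/
def IsCohenMacaulayLocal (R : Type u) [CommRing R] [IsLocalRing R] : Prop :=
  ∃ rs : List R, (∀ r ∈ rs, r ∈ IsLocalRing.maximalIdeal R) ∧
    RingTheory.Sequence.IsRegular R rs ∧ ((rs.length : ℕ) : WithBot ℕ∞) = ringKrullDim R

/-- Complete admissible rings: one-dimensional Noetherian local Cohen-Macaulay rings which are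
analytically reduced, residually rational, complete for the topology of the maximal ideal, and
whose residue field has at least as many elements as the ring has minimal primes. -/
structure IsCompleteAdmissible (R : Type u) [CommRing R] [IsLocalRing R] : Prop where
  noetherian : IsNoetherianRing R
  dim_eq_one : ringKrullDim R = 1
  cohenMacaulay : IsCohenMacaulayLocal R
  analyticallyReduced : IsReduced (AdicCompletion (IsLocalRing.maximalIdeal R) R)
  /-- Every residue field of the integral closure of `R` in its total ring of fractions is the
  residue field of `R`. -/
  residuallyRational : ∀ n : Ideal (integralClosure R (FractionRing R)), n.IsMaximal →
    Function.Surjective ((Ideal.Quotient.mk n).comp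
      (algebraMap R (integralClosure R (FractionRing R))))
  complete : IsAdicComplete (IsLocalRing.maximalIdeal R) R
  card_residueField :
    (minimalPrimes R).encard ≤ ENat.card (IsLocalRing.ResidueField R)

/-! ### Values in a discrete valuation ring -/

/-- `x = u ϖ ^ n` with `ϖ` irreducible and `u` a unit of `A`: for a discrete valuation ring `A`
with field of fractions `K` this says that the normalized valuation of `x` is `n`. -/
def HasValue (A : Type u) {K : Type u} [CommRing A] [Field K] [Algebra A K]
    (x : K) (n : ℤ) : Prop :=
  ∃ ϖ u : A, Irreducible ϖ ∧ IsUnit u ∧ x = algebraMap A K u * algebraMap A K ϖ ^ n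

/-! ### Branches and projections -/

section Branches

variable {R : Type u} [CommRing R]

instance isPrime_of_minimalPrimes (p : minimalPrimes R) : p.1.IsPrime := p.2.1.1

theorem le_comap_branch (p : minimalPrimes R) :
    R⁰ ≤ (R ⧸ p.1)⁰.comap (Ideal.Quotient.mk p.1) := by
  intro x hx
  rw [Submonoid.mem_comap, mem_nonZeroDivisors_iff_ne_zero, Ne, Ideal.Quotient.eq_zero_iff_mem]
  exact fun h => notMem_nonZeroDivisors_of_mem_mem_minimalPrimes h p.2 hx

theorem le_comap_inf {ι : Type*} (p : ι → minimalPrimes R) (J : Set ι) :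
    R⁰ ≤ (R ⧸ ⨅ j ∈ J, (p j).1)⁰.comap (Ideal.Quotient.mk (⨅ j ∈ J, (p j).1)) := by
  intro x hx
  rw [Submonoid.mem_comap, mem_nonZeroDivisors_iff_right]
  intro y hy
  obtain ⟨y, rfl⟩ := Ideal.Quotient.mk_surjective y
  rw [← map_mul, Ideal.Quotient.eq_zero_iff_mem] at hy
  rw [Ideal.Quotient.eq_zero_iff_mem]
  simp only [Ideal.mem_iInf] at hy ⊢
  intro j hj
  exact ((p j).2.1.1.mem_or_mem (hy j hj)).resolve_right
    fun h => notMem_nonZeroDivisors_of_mem_mem_minimalPrimes h (p j).2 hx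

/-- The projection `π_p : K → K_p` of the total ring of fractions `K` of `R` to the field of
fractions of `R ⧸ p`, for a minimal prime `p`. -/
noncomputable def branchProj (p : minimalPrimes R) :
    FractionRing R →+* FractionRing (R ⧸ p.1) :=
  IsLocalization.map (FractionRing (R ⧸ p.1)) (Ideal.Quotient.mk p.1) (le_comap_branch p)

/-- The projection `π_J : K → K_J`, where `K_J` is the total ring of fractions of
`R_J = R ⧸ ⋂_{j ∈ J} p_j`. -/
noncomputable def multiProj {ι : Type*} (p : ι → minimalPrimes R) (J : Set ι) :
    FractionRing R →+* FractionRing (R ⧸ ⨅ j ∈ J, (p j).1) :=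
  IsLocalization.map (FractionRing (R ⧸ ⨅ j ∈ J, (p j).1))
    (Ideal.Quotient.mk (⨅ j ∈ J, (p j).1)) (le_comap_inf p J)

/-- `v_p (π_p h) = n`, where `v_p` is the normalized valuation of the field of fractions of
`R ⧸ p` whose valuation ring is the integral closure of `R ⧸ p`. -/
def HasBranchValue (p : minimalPrimes R) (h : FractionRing R) (n : ℤ) : Prop :=
  HasValue (integralClosure (R ⧸ p.1) (FractionRing (R ⧸ p.1))) (branchProj p h) n

/-! ### Value sets of regular fractional ideals -/

/-- A fractional ideal of `R` is regular if it contains a regular element of `R`. -/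
def IsRegularIdeal (I : FractionalIdeal R⁰ (FractionRing R)) : Prop :=
  ∃ a ∈ R⁰, algebraMap R (FractionRing R) a ∈ I

/-- The value set `E = v (I \ Z(K))`, a set of vectors of integers indexed by the minimal
primes. -/
def valueSet {ι : Type*} (p : ι → minimalPrimes R) (I : FractionalIdeal R⁰ (FractionRing R)) :
    Set (ι → ℤ) :=
  {α | ∃ h ∈ I, h ∈ (FractionRing R)⁰ ∧ ∀ i, HasBranchValue (p i) h (α i)}

/-- The value set `E_J = v (π_J(I) \ Z(K_J))`. The `j`-th component of an element `π_J h` of `K_J`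
is `π_j h`. -/
def projValueSet {ι : Type*} (p : ι → minimalPrimes R)
    (I : FractionalIdeal R⁰ (FractionRing R)) (J : Set ι) : Set (J → ℤ) :=
  {α | ∃ h ∈ I, multiProj p J h ∈ (FractionRing (R ⧸ ⨅ j ∈ J, (p j).1))⁰ ∧
    ∀ j : J, HasBranchValue (p j) h (α j)}

/-- The value set `E_i = E_{{i}}`, as a set of integers. -/
def branchValueSet {ι : Type*} (p : ι → minimalPrimes R)
    (I : FractionalIdeal R⁰ (FractionRing R)) (i : ι) : Set ℤ :=
  {n | (fun _ => n) ∈ projValueSet p I {i}}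

end Branches

/-! ### Gaps, fibers and maximal points -/

/-- The gaps of a set of integers: the integers above its minimum that do not belong to it. -/
def gaps (S : Set ℤ) : Set ℤ :=
  {n | n ∉ S ∧ ∃ m, IsLeast S m ∧ m < n}

section Maximals

variable {κ : Type*}

/-- The fiber `F_J(A, α)`: the points of `A` with the same coordinates as `α` in `J` and strictly
greater ones outside `J`. -/
def fiber (A : Set (κ → ℤ)) (J : Set κ) (α : κ → ℤ) : Set (κ → ℤ) :=
  {β | β ∈ A ∧ (∀ j ∈ J, β j = α j) ∧ ∀ j ∉ J, α j < β j}

/-- The set `M(A)` of maximal points of `A`. -/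
def maximals (A : Set (κ → ℤ)) : Set (κ → ℤ) :=
  {α | α ∈ A ∧ ∀ i, fiber A {i} α = ∅}

/-- The set `RM(A)` of relative maximals of `A`. -/
def relMaximals (A : Set (κ → ℤ)) : Set (κ → ℤ) :=
  {α | α ∈ maximals A ∧ ∀ J : Set κ, J.Nontrivial → (fiber A J α).Nonempty}

/-- The set `AM(A)` of absolute maximals of `A`. -/
def absMaximals (A : Set (κ → ℤ)) : Set (κ → ℤ) :=
  {α | α ∈ maximals A ∧ ∀ J : Set κ, J.Nonempty → J ≠ Set.univ → fiber A J α = ∅}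

end Maximals

end AdmissibleRing

namespace AdmissibleRing

universe u

/-! ### Combinatorics of good sets of integer vectors -/

/-! Choose `γ` such that the module `C` of all `h` with `v_i(h) ≥ γ i` for every `i` lies in the
smaller ideal. The lengths of both ideals over the same `C` are computed and subtracted, and the
terms in `γ` cancel.

For one ideal `N` with value set `E`, impose `v_0 ≥ γ 0`, `v_1 ≥ γ 1`, `v_2 ≥ γ 2` one after the
other. By residual rationality the graded pieces have length at most one, so each cut has as length
the number of values below `γ i` still attained (`relLength_inf`). The first cut sees all values of
`E_0` below `γ 0`, whose number is `γ 0` minus the minimum minus the number of gaps. The second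
misses the values of `E_1` at which `v_0` stays below `γ 0`; these correspond to the maximals of the
projection of `E` to the coordinates 0 and 1 (`maximals_proj`). The third misses the values `n` of
`E_2` at which `v_0 ≥ γ 0` and `v_1 ≥ γ 1` never hold together.

To count those `n`, view the slice of `E` at height `n` as bounded by a staircase and count its
outer corners twice. A corner with points of the slice to its right is followed by an inner corner,
which is a relative maximal; a last corner with nothing to its right exists exactly when `v_0` is
bounded at `n`. On the other hand, a corner whose column is bounded has an absolute maximal on top;
an unbounded corner column occurs once for each counted `n` at which `v_1` is unbounded. Equating
the two counts gives `ncard_jointlyBoundedHeights`, and with it the length over `C`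
(`relLength_conductor`).

The algebra has to supply the filtration. The total ring of fractions is the product of the branch
fields. Each branch normalization is finite by a Krull–Akizuki length bound and a complete form of
Nakayama's lemma, and local by lifting idempotents, hence a discrete valuation ring. The three
minimal primes provide enough residue classes for `E` to be stable under infima. -/

/-- Abstract properties of the value set of a regular fractional ideal: stability under infima,
the exchange property, a lower bound `α` and a conductor `γ`. -/
structure IsGoodSet {ι : Type*} (E : Set (ι → ℤ)) (α γ : ι → ℤ) : Prop where
  inf_mem : ∀ β ∈ E, ∀ β' ∈ E, β ⊓ β' ∈ E
  exchange : ∀ β ∈ E, ∀ β' ∈ E, ∀ i, β i = β' i → ∃ ε ∈ E, β i < ε i ∧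
    ∀ j, min (β j) (β' j) ≤ ε j ∧ (β j ≠ β' j → ε j = min (β j) (β' j))
  lower : ∀ β ∈ E, α ≤ β
  conductor : ∀ β, γ ≤ β → β ∈ E

/-- The heights `n` in direction `j` at which the `i`-th coordinate is bounded. -/
def boundedHeights {ι : Type*} (E : Set (ι → ℤ)) (γ : ι → ℤ) (i j : ι) : Set ℤ :=
  {n | (∃ β ∈ E, β j = n) ∧ ∀ β ∈ E, β j = n → β i < γ i}

theorem exists_max_of_bounded {S : Set ℤ} (h : S.Nonempty) {b : ℤ} (hb : ∀ x ∈ S, x < b) :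
    ∃ m ∈ S, ∀ x ∈ S, x ≤ m := by
  obtain ⟨x, hx⟩ := h
  obtain ⟨m, hm, hm'⟩ := Int.exists_greatest_of_bdd (P := fun z => z ∈ S)
    ⟨b, fun z hz => (hb z hz).le⟩ ⟨x, hx⟩
  exact ⟨m, hm, hm'⟩

theorem exists_min_of_bounded {S : Set ℤ} (h : S.Nonempty) {b : ℤ} (hb : ∀ x ∈ S, b ≤ x) :
    ∃ m ∈ S, ∀ x ∈ S, m ≤ x := by
  obtain ⟨x, hx⟩ := h
  obtain ⟨m, hm, hm'⟩ := Int.exists_least_of_bdd (P := fun z => z ∈ S)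
    ⟨b, fun z hz => hb z hz⟩ ⟨x, hx⟩
  exact ⟨m, hm, hm'⟩

namespace IsGoodSet

section General

variable {ι : Type*} {E : Set (ι → ℤ)} {α γ : ι → ℤ}

/-- Exchange with a conductor point that agrees at `i` raises that coordinate alone. Hence a
coordinate that has reached `γ i` behaves like an infinite one. -/
theorem raise (hE : IsGoodSet E α γ) {β : ι → ℤ} (hβ : β ∈ E) {i : ι} (hi : γ i ≤ β i)
    (N : ℤ) : ∃ ε ∈ E, N ≤ ε i ∧ ∀ j, j ≠ i → ε j = β j := by
  classical
  have key : ∀ k : ℕ, ∃ ε ∈ E, β i + k ≤ ε i ∧ ∀ j, j ≠ i → ε j = β j := by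
    intro k
    induction k with
    | zero => exact ⟨β, hβ, by simp, fun _ _ => rfl⟩
    | succ k ih =>
      obtain ⟨ε, hε, h1, h2⟩ := ih
      -- The `+ 1` makes the two points differ off `i`, so exchange returns exactly the minimum `ε
      -- j` there.
      obtain ⟨δ, hδ, h3, h4⟩ := hE.exchange ε hε
        (fun j => if j = i then ε i else max (ε j + 1) (γ j)) (hE.conductor _ fun j => by
          by_cases hj : j = i
          · subst hj; simp; omega
          · simp [hj]) i (by simp)
      refine ⟨δ, hδ, by push_cast; omega, fun j hj => ?_⟩
      have := (h4 j).2 (by simp only [hj, if_false]; omega)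
      simp only [hj, if_false] at this
      rw [this, ← h2 j hj]
      omega
  obtain ⟨ε, hε, h1, h2⟩ := key (N - β i).toNat
  exact ⟨ε, hε, by omega, h2⟩

theorem exists_isLeast [Finite ι] (hE : IsGoodSet E α γ) : ∃ m, IsLeast E m := by
  have hne : E.Nonempty := ⟨γ, hE.conductor _ le_rfl⟩
  have h1 : ∀ i, ∃ β ∈ E, ∀ β' ∈ E, β i ≤ β' i := by
    intro i
    obtain ⟨m, ⟨β, hβ, rfl⟩, hm⟩ := exists_min_of_bounded (S := (fun β => β i) '' E)
      (hne.image _) (b := α i) (by rintro _ ⟨β, hβ, rfl⟩; exact hE.lower β hβ i)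
    exact ⟨β, hβ, fun β' hβ' => hm _ ⟨β', hβ', rfl⟩⟩
  choose b hb hb' using h1
  cases nonempty_fintype ι
  have h2 : ∀ s : Finset ι, ∃ β ∈ E, ∀ i ∈ s, ∀ β' ∈ E, β i ≤ β' i := by
    classical
    intro s
    induction s using Finset.induction_on with
    | empty => exact ⟨γ, hE.conductor _ le_rfl, by simp⟩
    | insert i s _ ih =>
      obtain ⟨β, hβ, h⟩ := ih
      refine ⟨β ⊓ b i, hE.inf_mem _ hβ _ (hb i), fun j hj β' hβ' => ?_⟩
      rcases Finset.mem_insert.1 hj with rfl | hj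
      · exact inf_le_right.trans (hb' _ β' hβ')
      · exact inf_le_left.trans (h j hj β' hβ')
  obtain ⟨β, hβ, h⟩ := h2 Finset.univ
  exact ⟨β, hβ, fun β' hβ' i => h i (Finset.mem_univ _) β' hβ'⟩

theorem lower_of_isLeast (hE : IsGoodSet E α γ) {m : ι → ℤ} (hm : IsLeast E m) :
    IsGoodSet E m γ :=
  ⟨hE.inf_mem, hE.exchange, fun _ hβ => hm.2 hβ, hE.conductor⟩

/-- From height `γ j` on, a conductor point has `i`-th coordinate `γ i`, which is no longer below
the bound. -/
theorem boundedHeights_subset (hE : IsGoodSet E α γ) {i j : ι} (hij : i ≠ j) :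
    boundedHeights E γ i j ⊆ Set.Ico (α j) (γ j) := by
  classical
  rintro n ⟨⟨β, hβ, rfl⟩, h⟩
  refine ⟨hE.lower β hβ j, ?_⟩
  by_contra! hc
  have := h (fun k => if k = j then β j else γ k) (hE.conductor _ fun k => by
    by_cases hk : k = j
    · subst hk; simpa using hc
    · simp [hk]) (by simp)
  simp [hij] at this

theorem boundedHeights_finite (hE : IsGoodSet E α γ) {i j : ι} (hij : i ≠ j) :
    (boundedHeights E γ i j).Finite :=
  (Set.finite_Ico _ _).subset (hE.boundedHeights_subset hij)

/-- The gaps of the projection of a good set to a coordinate. -/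
theorem gaps_proj (hE : IsGoodSet E α γ) (hα : α ∈ E) (i : ι) :
    (gaps {n | ∃ β ∈ E, β i = n}).Finite ∧
    ({n | n < γ i ∧ ∃ β ∈ E, β i = n}.ncard : ℤ) +
      (gaps {n | ∃ β ∈ E, β i = n}).ncard = γ i - α i := by
  classical
  have hle : α i ≤ γ i := hE.lower γ (hE.conductor _ le_rfl) i
  have hleast : IsLeast {n | ∃ β ∈ E, β i = n} (α i) :=
    ⟨⟨α, hα, rfl⟩, by rintro _ ⟨β, hβ, rfl⟩; exact hE.lower β hβ i⟩
  have hbig : ∀ n, γ i ≤ n → ∃ β ∈ E, β i = n := fun n hn =>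
    ⟨fun k => if k = i then n else γ k, hE.conductor _ fun k => by
      by_cases hk : k = i
      · subst hk; simpa using hn
      · simp [hk], by simp⟩
  have hsub : gaps {n | ∃ β ∈ E, β i = n} ⊆ Set.Ico (α i) (γ i) := by
    rintro n ⟨h1, m, hm, hmn⟩
    have := hm.unique hleast
    refine ⟨by omega, ?_⟩
    by_contra! hc
    exact h1 (hbig n hc)
  have hfin := (Set.finite_Ico _ _).subset hsub
  refine ⟨hfin, ?_⟩
  have hsub2 : {n | n < γ i ∧ ∃ β ∈ E, β i = n} ⊆ Set.Ico (α i) (γ i) := by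
    rintro n ⟨h1, β, hβ, rfl⟩
    exact ⟨hE.lower β hβ i, h1⟩
  have hfin2 := (Set.finite_Ico _ _).subset hsub2
  have hdisj : Disjoint {n | n < γ i ∧ ∃ β ∈ E, β i = n} (gaps {n | ∃ β ∈ E, β i = n}) := by
    rw [Set.disjoint_left]
    rintro n ⟨_, h⟩ ⟨h', _⟩
    exact h' h
  have hunion : {n | n < γ i ∧ ∃ β ∈ E, β i = n} ∪ gaps {n | ∃ β ∈ E, β i = n} =
      Set.Ico (α i) (γ i) := by
    refine (Set.union_subset hsub2 hsub).antisymm fun n hn => ?_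
    by_cases h : ∃ β ∈ E, β i = n
    · exact Or.inl ⟨hn.2, h⟩
    · refine Or.inr ⟨h, α i, hleast, lt_of_le_of_ne hn.1 ?_⟩
      rintro rfl
      exact h ⟨α, hα, rfl⟩
  have := Set.ncard_union_eq hdisj hfin2 hfin
  rw [hunion, ← Finset.coe_Ico, Set.ncard_coe_finset, Int.card_Ico] at this
  omega

/-- Maximals of the projection of a good set to two coordinates. -/
theorem maximals_proj (hE : IsGoodSet E α γ) {i j : ι} (hij : i ≠ j)
    {A : Set (({i, j} : Set ι) → ℤ)} (hA : A = (fun β (k : ({i, j} : Set ι)) => β k) '' E) :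
    (maximals A).Finite ∧ (maximals A).ncard = (boundedHeights E γ i j).ncard := by
  have hi : i ∈ ({i, j} : Set ι) := by simp
  have hj : j ∈ ({i, j} : Set ι) := by simp
  have hcases : ∀ k : ({i, j} : Set ι), k = ⟨i, hi⟩ ∨ k = ⟨j, hj⟩ := by
    rintro ⟨k, rfl | rfl⟩
    · exact Or.inl rfl
    · exact Or.inr rfl
  have hne : (⟨i, hi⟩ : ({i, j} : Set ι)) ≠ ⟨j, hj⟩ := fun h => hij (congrArg Subtype.val h)
  have hfib : ∀ (β : ({i, j} : Set ι) → ℤ) (ε : ι → ℤ), ε ∈ E → ε j = β ⟨j, hj⟩ →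
      β ⟨i, hi⟩ < ε i → (fiber A {⟨j, hj⟩} β).Nonempty := by
    intro β ε hε h1 h2
    refine ⟨fun k => ε k, hA ▸ ⟨ε, hε, rfl⟩, ?_, ?_⟩
    · rintro k rfl; exact h1
    · intro k hk
      rcases hcases k with rfl | rfl
      · exact h2
      · exact absurd rfl hk
  -- At a given height the `i`-th coordinates are either bounded, and the rightmost point is
  -- maximal, or can be raised at will, and no point is maximal.
  have himage : (fun β : ({i, j} : Set ι) → ℤ => β ⟨j, hj⟩) '' maximals A =
      boundedHeights E γ i j := by
    ext n
    constructor
    · rintro ⟨β, ⟨hβ, hmax⟩, rfl⟩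
      have hβ' := hβ
      rw [hA] at hβ'
      obtain ⟨b, hb, rfl⟩ := hβ'
      refine ⟨⟨b, hb, rfl⟩, fun β' hβ' h => ?_⟩
      by_contra! hc
      obtain ⟨ε, hε, h1, h2⟩ := hE.raise hβ' hc (b i + 1)
      have := hfib (fun k => b k) ε hε (by rw [h2 j hij.symm]; exact h) (by simp only; omega)
      rw [hmax] at this
      exact Set.not_nonempty_empty this
    · rintro ⟨⟨b, hb, rfl⟩, h⟩
      obtain ⟨_, ⟨c, ⟨hc, hcj⟩, rfl⟩, hmax⟩ := exists_max_of_bounded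
        (S := (fun β => β i) '' {β | β ∈ E ∧ β j = b j}) ⟨_, b, ⟨hb, rfl⟩, rfl⟩ (b := γ i)
        (by rintro _ ⟨β, ⟨hβ, h'⟩, rfl⟩; exact h β hβ h')
      refine ⟨fun k => c k, ⟨hA ▸ ⟨c, hc, rfl⟩, fun k => ?_⟩, hcj⟩
      rw [Set.eq_empty_iff_forall_notMem]
      rintro δ ⟨hδ, h1, h2⟩
      rw [hA] at hδ
      obtain ⟨d, hd, rfl⟩ := hδ
      rcases hcases k with rfl | rfl
      · have h3 : d i = c i := h1 ⟨i, hi⟩ rfl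
        have h4 : c j < d j := h2 ⟨j, hj⟩ fun h => hne (Set.mem_singleton_iff.1 h).symm
        -- A point straight above the rightmost one would yield a point further right at the old
        -- height.
        obtain ⟨ε, hε, h5, h6⟩ := hE.exchange c hc d hd i h3.symm
        have h7 := (h6 j).2 h4.ne
        have := hmax (ε i) ⟨ε, ⟨hε, by omega⟩, rfl⟩
        simp only at this
        omega
      · have h3 : d j = c j := h1 ⟨j, hj⟩ rfl
        have h4 : c i < d i := h2 ⟨i, hi⟩ fun h => hne (Set.mem_singleton_iff.1 h)
        have := hmax (d i) ⟨d, ⟨hd, by omega⟩, rfl⟩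
        simp only at this
        omega
  have hinj : Set.InjOn (fun β : ({i, j} : Set ι) → ℤ => β ⟨j, hj⟩) (maximals A) := by
    have key : ∀ β ∈ maximals A, ∀ β' ∈ maximals A, β ⟨j, hj⟩ = β' ⟨j, hj⟩ →
        β' ⟨i, hi⟩ ≤ β ⟨i, hi⟩ := by
      intro β hβ β' hβ' h
      by_contra! hc
      have h1 := hβ'.1
      rw [hA] at h1
      obtain ⟨b, hb, rfl⟩ := h1
      have := hfib β b hb h.symm hc
      rw [hβ.2] at this
      exact Set.not_nonempty_empty this
    intro β hβ β' hβ' h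
    funext k
    rcases hcases k with rfl | rfl
    · exact (key β' hβ' β hβ h.symm).antisymm (key β hβ β' hβ' h)
    · exact h
  refine ⟨Set.Finite.of_finite_image ?_ hinj, ?_⟩
  · rw [himage]; exact hE.boundedHeights_finite hij
  · rw [← himage, hinj.ncard_image]

end General

end IsGoodSet

/-! ### Fibers and maximals in three coordinates -/

theorem mem_fiber_fin_three {E : Set (Fin 3 → ℤ)} {J : Set (Fin 3)} {α β : Fin 3 → ℤ} :
    β ∈ fiber E J α ↔ β ∈ E ∧ ((0 ∈ J → β 0 = α 0) ∧ (0 ∉ J → α 0 < β 0)) ∧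
      ((1 ∈ J → β 1 = α 1) ∧ (1 ∉ J → α 1 < β 1)) ∧
      ((2 ∈ J → β 2 = α 2) ∧ (2 ∉ J → α 2 < β 2)) := by
  simp only [fiber, Set.mem_ofPred_eq, Fin.forall_fin_succ,
    IsEmpty.forall_iff, and_true, Fin.isValue, Fin.succ_zero_eq_one, Fin.succ_one_eq_two]
  tauto

theorem mem_maximals_fin_three {E : Set (Fin 3 → ℤ)} {α : Fin 3 → ℤ} :
    α ∈ maximals E ↔ α ∈ E ∧ (∀ β ∈ E, β 0 = α 0 → α 1 < β 1 → ¬ α 2 < β 2) ∧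
      (∀ β ∈ E, β 1 = α 1 → α 0 < β 0 → ¬ α 2 < β 2) ∧
      (∀ β ∈ E, β 2 = α 2 → α 0 < β 0 → ¬ α 1 < β 1) := by
  simp only [maximals, Set.mem_ofPred_eq, Set.eq_empty_iff_forall_notMem, Fin.forall_fin_succ,
    mem_fiber_fin_three]
  simp
  grind

theorem mem_relMaximals_fin_three {E : Set (Fin 3 → ℤ)} {α : Fin 3 → ℤ} :
    α ∈ relMaximals E ↔ α ∈ maximals E ∧ (∃ β ∈ E, β 0 = α 0 ∧ β 1 = α 1 ∧ α 2 < β 2) ∧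
      (∃ β ∈ E, β 0 = α 0 ∧ β 2 = α 2 ∧ α 1 < β 1) ∧
      (∃ β ∈ E, β 1 = α 1 ∧ β 2 = α 2 ∧ α 0 < β 0) := by
  simp only [relMaximals, Set.mem_ofPred_eq, Set.Nonempty, mem_fiber_fin_three]
  refine and_congr_right fun hα => ⟨fun h => ⟨?_, ?_, ?_⟩, fun h J hJ => ?_⟩
  · obtain ⟨β, hβ⟩ := h {0, 1} ⟨0, by simp, 1, by simp, by simp⟩
    simp at hβ
    exact ⟨β, by tauto⟩
  · obtain ⟨β, hβ⟩ := h {0, 2} ⟨0, by simp, 2, by simp, by simp⟩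
    simp at hβ
    exact ⟨β, by tauto⟩
  · obtain ⟨β, hβ⟩ := h {1, 2} ⟨1, by simp, 2, by simp, by simp⟩
    simp at hβ
    exact ⟨β, by tauto⟩
  · have hJ' : (0 ∈ J ∧ 1 ∈ J) ∨ (0 ∈ J ∧ 2 ∈ J) ∨ (1 ∈ J ∧ 2 ∈ J) := by
      obtain ⟨a, ha, b, hb, hab⟩ := hJ
      fin_cases a <;> fin_cases b <;> simp_all
    obtain ⟨⟨b, hb⟩, ⟨c, hc⟩, ⟨d, hd⟩⟩ := h
    by_cases h0 : 0 ∈ J <;> by_cases h1 : 1 ∈ J <;> by_cases h2 : 2 ∈ J <;>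
      simp only [h0, h1, h2, true_and, and_false, or_false, not_true_eq_false,
        not_false_eq_true, true_imp_iff, false_imp_iff, and_true] at hJ' ⊢
    -- Here `J` is the whole index set and `α` lies in its own fiber.
    · exact ⟨α, hα.1, rfl, rfl, rfl⟩
    · exact ⟨b, hb⟩
    · exact ⟨c, hc.1, hc.2.1, hc.2.2.2, hc.2.2.1⟩
    · exact ⟨d, hd.1, hd.2.2.2, hd.2.1, hd.2.2.1⟩

theorem mem_absMaximals_fin_three {E : Set (Fin 3 → ℤ)} {α : Fin 3 → ℤ} :
    α ∈ absMaximals E ↔ α ∈ maximals E ∧ (∀ β ∈ E, β 0 = α 0 → β 1 = α 1 → ¬ α 2 < β 2) ∧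
      (∀ β ∈ E, β 0 = α 0 → β 2 = α 2 → ¬ α 1 < β 1) ∧
      (∀ β ∈ E, β 1 = α 1 → β 2 = α 2 → ¬ α 0 < β 0) := by
  have hne : ∀ (J : Set (Fin 3)) (i : Fin 3), i ∉ J → J ≠ Set.univ := by
    rintro _ i hi rfl
    exact hi (Set.mem_univ i)
  simp only [absMaximals, Set.mem_ofPred_eq, Set.eq_empty_iff_forall_notMem, mem_fiber_fin_three]
  refine and_congr_right fun hα => ⟨fun h => ⟨?_, ?_, ?_⟩, fun h J hJ hJ' β => ?_⟩
  · intro β hβ h1 h2 h3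
    exact h {0, 1} ⟨0, by simp⟩ (hne _ 2 (by simp)) β (by simp [hβ, h1, h2, h3])
  · intro β hβ h1 h2 h3
    exact h {0, 2} ⟨0, by simp⟩ (hne _ 1 (by simp)) β (by simp [hβ, h1, h2, h3])
  · intro β hβ h1 h2 h3
    exact h {1, 2} ⟨1, by simp⟩ (hne _ 0 (by simp)) β (by simp [hβ, h1, h2, h3])
  -- Maximality already settles the singletons, so only the pairs use the extra conditions.
  · rw [mem_maximals_fin_three] at hα
    obtain ⟨-, h3, h4, h5⟩ := hα
    obtain ⟨h6, h7, h8⟩ := h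
    have hex : 0 ∈ J ∨ 1 ∈ J ∨ 2 ∈ J := by
      obtain ⟨a, ha⟩ := hJ
      fin_cases a <;> simp_all
    have hnot : 0 ∉ J ∨ 1 ∉ J ∨ 2 ∉ J := by
      by_contra! hc
      exact hJ' (Set.eq_univ_of_forall fun i => by fin_cases i <;> simp_all)
    rintro ⟨hβ, ⟨a, a'⟩, ⟨b, b'⟩, ⟨c, c'⟩⟩
    by_cases h0 : 0 ∈ J <;> by_cases h1 : 1 ∈ J <;> by_cases h2 : 2 ∈ J <;>
      simp only [h0, h1, h2, not_true_eq_false,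
        not_false_eq_true, true_imp_iff, false_imp_iff, or_false] at hex hnot a a' b b' c c'
    · exact h6 β hβ a b c'
    · exact h7 β hβ a c b'
    · exact h3 β hβ a b' c'
    · exact h8 β hβ b c a'
    · exact h4 β hβ b a' c'
    · exact h5 β hβ c a' b'

/-! ### Counting the corners of horizontal slices -/

namespace IsGoodSet

variable {E : Set (Fin 3 → ℤ)} {α γ : Fin 3 → ℤ}

theorem exchange_zero (hE : IsGoodSet E α γ) {β β' : Fin 3 → ℤ} (hβ : β ∈ E) (hβ' : β' ∈ E)
    (h : β 0 = β' 0) : ∃ ε ∈ E, β 0 < ε 0 ∧ min (β 1) (β' 1) ≤ ε 1 ∧ min (β 2) (β' 2) ≤ ε 2 ∧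
      (β 1 ≠ β' 1 → ε 1 = min (β 1) (β' 1)) ∧ (β 2 ≠ β' 2 → ε 2 = min (β 2) (β' 2)) := by
  obtain ⟨ε, hε, h0, h1⟩ := hE.exchange β hβ β' hβ' 0 h
  exact ⟨ε, hε, h0, (h1 1).1, (h1 2).1, (h1 1).2, (h1 2).2⟩

theorem exchange_one (hE : IsGoodSet E α γ) {β β' : Fin 3 → ℤ} (hβ : β ∈ E) (hβ' : β' ∈ E)
    (h : β 1 = β' 1) : ∃ ε ∈ E, β 1 < ε 1 ∧ min (β 0) (β' 0) ≤ ε 0 ∧ min (β 2) (β' 2) ≤ ε 2 ∧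
      (β 0 ≠ β' 0 → ε 0 = min (β 0) (β' 0)) ∧ (β 2 ≠ β' 2 → ε 2 = min (β 2) (β' 2)) := by
  obtain ⟨ε, hε, h0, h1⟩ := hE.exchange β hβ β' hβ' 1 h
  exact ⟨ε, hε, h0, (h1 0).1, (h1 2).1, (h1 0).2, (h1 2).2⟩

theorem exchange_two (hE : IsGoodSet E α γ) {β β' : Fin 3 → ℤ} (hβ : β ∈ E) (hβ' : β' ∈ E)
    (h : β 2 = β' 2) : ∃ ε ∈ E, β 2 < ε 2 ∧ min (β 0) (β' 0) ≤ ε 0 ∧ min (β 1) (β' 1) ≤ ε 1 ∧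
      (β 0 ≠ β' 0 → ε 0 = min (β 0) (β' 0)) ∧ (β 1 ≠ β' 1 → ε 1 = min (β 1) (β' 1)) := by
  obtain ⟨ε, hε, h0, h1⟩ := hE.exchange β hβ β' hβ' 2 h
  exact ⟨ε, hε, h0, (h1 0).1, (h1 1).1, (h1 0).2, (h1 1).2⟩

/-- The heights at which the first two coordinates are not simultaneously unbounded. -/
def jointlyBoundedHeights (E : Set (Fin 3 → ℤ)) (γ : Fin 3 → ℤ) : Set ℤ :=
  {n | (∃ β ∈ E, β 2 = n) ∧ ∀ β ∈ E, β 2 = n → γ 0 ≤ β 0 → β 1 < γ 1}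

/-- The columns `(a, n)` of the corners of the staircase bounding the slice of `E` at height `n`. -/
def corners (E : Set (Fin 3 → ℤ)) (γ : Fin 3 → ℤ) : Set (ℤ × ℤ) :=
  {q | q.2 ∈ jointlyBoundedHeights E γ ∧ ∃ β ∈ E, β 0 = q.1 ∧ β 2 = q.2 ∧
    ∀ β' ∈ E, β' 2 = q.2 → q.1 < β' 0 → β' 1 < β 1}

theorem jointlyBoundedHeights_subset (hE : IsGoodSet E α γ) :
    jointlyBoundedHeights E γ ⊆ Set.Ico (α 2) (γ 2) := by
  rintro n ⟨⟨β, hβ, rfl⟩, h⟩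
  refine ⟨hE.lower β hβ 2, ?_⟩
  by_contra! hc
  have := h ![γ 0, γ 1, β 2] (hE.conductor _ fun i => by fin_cases i <;> simp [hc])
    (by simp) (by simp)
  simp at this

theorem jointlyBoundedHeights_finite (hE : IsGoodSet E α γ) :
    (jointlyBoundedHeights E γ).Finite :=
  (Set.finite_Ico _ _).subset hE.jointlyBoundedHeights_subset

/-- A corner at or beyond `γ 0` could be moved right without lowering its second coordinate, against
the strict drop. -/
theorem corners_fst_lt (hE : IsGoodSet E α γ) {q : ℤ × ℤ} (hq : q ∈ corners E γ) :
    q.1 < γ 0 := by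
  obtain ⟨-, β, hβ, h0, h2, h⟩ := hq
  by_contra! hc
  obtain ⟨ε, hε, h3, h4⟩ := hE.raise hβ (i := 0) (by omega) (β 0 + 1)
  have := h ε hε (by rw [h4 2 (by simp), h2]) (by omega)
  rw [h4 1 (by simp)] at this
  exact lt_irrefl _ this

theorem corners_finite (hE : IsGoodSet E α γ) : (corners E γ).Finite := by
  refine ((Set.finite_Ico (α 0) (γ 0)).prod (Set.finite_Ico (α 2) (γ 2))).subset fun q hq => ?_
  refine ⟨⟨?_, hE.corners_fst_lt hq⟩, hE.jointlyBoundedHeights_subset hq.1⟩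
  obtain ⟨-, β, hβ, h0, -⟩ := hq
  exact h0 ▸ hE.lower β hβ 0

theorem exists_raise_both (hE : IsGoodSet E α γ) {β : Fin 3 → ℤ} (hβ : β ∈ E)
    (h0 : γ 0 ≤ β 0) (h1 : γ 1 ≤ β 1) (a b : ℤ) :
    ∃ ε ∈ E, a < ε 0 ∧ b < ε 1 ∧ ε 2 = β 2 := by
  obtain ⟨ε, hε, h3, h4⟩ := hE.raise hβ h0 (a + 1)
  obtain ⟨δ, hδ, h5, h6⟩ := hE.raise hε (i := 1) (by rw [h4 1 (by simp)]; exact h1) (b + 1)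
  exact ⟨δ, hδ, by rw [h6 0 (by simp)]; omega, by omega,
    by rw [h6 2 (by simp), h4 2 (by simp)]⟩

/-- If some point of the slice reached both `γ 0` and `γ 1`, it could be raised past `β` in both
directions. -/
theorem mem_jointlyBoundedHeights (hE : IsGoodSet E α γ) {β : Fin 3 → ℤ} (hβ : β ∈ E)
    (h : ∀ β' ∈ E, β' 2 = β 2 → β 0 < β' 0 → ¬ β 1 < β' 1) :
    β 2 ∈ jointlyBoundedHeights E γ := by
  refine ⟨⟨β, hβ, rfl⟩, fun β' hβ' h2 h0 => ?_⟩
  by_contra! h1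
  obtain ⟨ε, hε, h3, h4, h5⟩ := hE.exists_raise_both hβ' h0 h1 (β 0) (β 1)
  exact h ε hε (h5.trans h2) h3 h4

/-- The higher of two relative maximals over one pair has a point to its right in the slice (fiber
of `{1, 2}`), and that point lies in the fiber of `{2}` at the lower one, which is empty. -/
theorem injOn_relMaximals :
    Set.InjOn (fun β : Fin 3 → ℤ => (β 0, β 2)) (relMaximals E) := by
  have key : ∀ β ∈ relMaximals E, ∀ β' ∈ relMaximals E, (β 0, β 2) = (β' 0, β' 2) →
      β' 1 ≤ β 1 := by
    intro β hβ β' hβ' h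
    rw [mem_relMaximals_fin_three, mem_maximals_fin_three] at hβ hβ'
    obtain ⟨h0, h2⟩ := Prod.mk.inj h
    by_contra! hc
    obtain ⟨-, -, -, ε, hε, h3, h4, h5⟩ := hβ'
    exact hβ.1.2.2.2 ε hε (by omega) (by omega) (by omega)
  intro β hβ β' hβ' h
  have h' := Prod.mk.inj h
  have h1 := (key β' hβ' β hβ h.symm).antisymm (key β hβ β' hβ' h)
  ext i
  fin_cases i
  exacts [h'.1, h1, h'.2]

/-- The higher of two absolute maximals over one pair would lie in the fiber of `{0, 2}` at the
lower one. -/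
theorem injOn_absMaximals :
    Set.InjOn (fun β : Fin 3 → ℤ => (β 0, β 2)) (absMaximals E) := by
  have key : ∀ β ∈ absMaximals E, ∀ β' ∈ absMaximals E, (β 0, β 2) = (β' 0, β' 2) →
      β' 1 ≤ β 1 := by
    intro β hβ β' hβ' h
    rw [mem_absMaximals_fin_three] at hβ hβ'
    obtain ⟨h0, h2⟩ := Prod.mk.inj h
    by_contra! hc
    exact hβ.2.2.1 β' hβ'.1.1 h0.symm h2.symm hc
  intro β hβ β' hβ' h
  have h' := Prod.mk.inj h
  have h1 := (key β' hβ' β hβ h.symm).antisymm (key β hβ β' hβ' h)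
  ext i
  fin_cases i
  exacts [h'.1, h1, h'.2]

/-- Relative maximals are the inner corners of the staircase: each sits in an outer corner column,
at the greatest second coordinate occurring to the right of it. -/
theorem image_relMaximals (hE : IsGoodSet E α γ) :
    (fun β : Fin 3 → ℤ => (β 0, β 2)) '' relMaximals E =
      {q ∈ corners E γ | ∃ β ∈ E, β 2 = q.2 ∧ q.1 < β 0} := by
  ext ⟨a, n⟩
  constructor
  · rintro ⟨β, hβ, h⟩
    obtain ⟨rfl, rfl⟩ := Prod.mk.inj h
    rw [mem_relMaximals_fin_three, mem_maximals_fin_three] at hβ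
    obtain ⟨⟨hβE, -, -, h3⟩, -, ⟨δ, hδ, h5, h6, h7⟩, ⟨ε, hε, h8, h9, h10⟩⟩ := hβ
    refine ⟨⟨hE.mem_jointlyBoundedHeights hβE h3, δ, hδ, h5, h6, fun β' hβ' h11 h12 => ?_⟩,
      ε, hε, h9, h10⟩
    have := h3 β' hβ' h11 h12
    omega
  · rintro ⟨⟨hn, β, hβ, h0, h2, h⟩, ⟨β₁, hβ₁, h3, h4⟩⟩
    simp only at h0 h2 h h3 h4
    obtain ⟨_, ⟨δ, ⟨hδ, h5, h6⟩, rfl⟩, hmax⟩ := exists_max_of_bounded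
      (S := (fun β => β 1) '' {β | β ∈ E ∧ β 2 = n ∧ a < β 0}) ⟨_, β₁, ⟨hβ₁, h3, h4⟩, rfl⟩
      (b := β 1) (by rintro _ ⟨β', ⟨hβ', h', h''⟩, rfl⟩; exact h β' hβ' h' h'')
    have hmax' : ∀ β' ∈ E, β' 2 = n → a < β' 0 → β' 1 ≤ δ 1 := fun β' hβ' h' h'' =>
      hmax _ ⟨β', ⟨hβ', h', h''⟩, rfl⟩
    have h7 := h δ hδ h5 h6
    -- The inner corner is the infimum of a point `β` of the corner column and a highest point `δ`
    -- to its right.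
    have hε := hE.inf_mem β hβ δ hδ
    have e0 : (β ⊓ δ) 0 = a := by simp only [Pi.inf_apply]; omega
    have e1 : (β ⊓ δ) 1 = δ 1 := by simp only [Pi.inf_apply]; omega
    have e2 : (β ⊓ δ) 2 = n := by simp only [Pi.inf_apply]; omega
    refine ⟨β ⊓ δ, ?_, by simp only [e0, e2]⟩
    rw [mem_relMaximals_fin_three, mem_maximals_fin_three, e0, e1, e2]
    refine ⟨⟨hε, ?_, ?_, ?_⟩, ?_, ⟨β, hβ, h0, h2, h7⟩, ⟨δ, hδ, rfl, h5, h6⟩⟩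
    · intro x hx x0 x1 x2
      obtain ⟨y, hy, y0, y1, y2, -, y4⟩ := hE.exchange_zero hβ hx (by omega)
      have := hmax' y hy (by omega) (by omega)
      omega
    · intro x hx x1 x0 x2
      obtain ⟨y, hy, y1, y0, y2, -, y4⟩ := hE.exchange_one hδ hx (by omega)
      have := hmax' y hy (by omega) (by omega)
      omega
    · intro x hx x2 x0 x1
      have := hmax' x hx x2 x0
      omega
    -- `β` and `δ` have the same height and differ in the other two coordinates, so exchange gives a
    -- point strictly above their infimum.
    · obtain ⟨y, hy, y2, y0, y1, y3, y4⟩ := hE.exchange_two hβ hδ (by omega)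
      exact ⟨y, hy, by omega, by omega, by omega⟩

/-- An absolute maximal is the top of a bounded outer corner column. Exchange turns any point of a
forbidden fiber into a point of the slice that is higher in the column or too high to its right. -/
theorem image_absMaximals (hE : IsGoodSet E α γ) :
    (fun β : Fin 3 → ℤ => (β 0, β 2)) '' absMaximals E =
      {q ∈ corners E γ | ∀ β ∈ E, β 0 = q.1 → β 2 = q.2 → β 1 < γ 1} := by
  ext ⟨a, n⟩
  constructor
  · rintro ⟨β, hβ, h⟩
    obtain ⟨rfl, rfl⟩ := Prod.mk.inj h
    rw [mem_absMaximals_fin_three, mem_maximals_fin_three] at hβ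
    obtain ⟨⟨hβE, -, -, h3⟩, -, h4, h5⟩ := hβ
    refine ⟨⟨hE.mem_jointlyBoundedHeights hβE h3, β, hβE, rfl, rfl,
      fun β' hβ' h11 h12 => ?_⟩, fun β' hβ' h6 h7 => ?_⟩
    · have := h3 β' hβ' h11 h12
      by_contra! hc
      exact h5 β' hβ' (by omega) h11 h12
    · by_contra! hc
      obtain ⟨ε, hε, h8, h9⟩ := hE.raise hβ' hc (β 1 + 1)
      exact h4 ε hε (by rw [h9 0 (by simp), h6]) (by rw [h9 2 (by simp), h7]) (by omega)
  · rintro ⟨⟨hn, β, hβ, h0, h2, h⟩, h3⟩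
    simp only at h0 h2 h h3
    obtain ⟨_, ⟨δ, ⟨hδ, h5, h6⟩, rfl⟩, hmax⟩ := exists_max_of_bounded
      (S := (fun β => β 1) '' {β | β ∈ E ∧ β 0 = a ∧ β 2 = n}) ⟨_, β, ⟨hβ, h0, h2⟩, rfl⟩
      (b := γ 1) (by rintro _ ⟨β', ⟨hβ', h', h''⟩, rfl⟩; exact h3 β' hβ' h' h'')
    have hmax' : ∀ β' ∈ E, β' 0 = a → β' 2 = n → β' 1 ≤ δ 1 := fun β' hβ' h' h'' =>
      hmax _ ⟨β', ⟨hβ', h', h''⟩, rfl⟩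
    have h7 := hmax' β hβ h0 h2
    refine ⟨δ, ?_, by simp only [h5, h6]⟩
    rw [mem_absMaximals_fin_three, mem_maximals_fin_three, h5, h6]
    refine ⟨⟨hδ, ?_, ?_, ?_⟩, ?_, ?_, ?_⟩
    · intro x hx x0 x1 x2
      obtain ⟨y, hy, y0, y1, y2, -, y4⟩ := hE.exchange_zero hδ hx (by omega)
      have := h y hy (by omega) (by omega)
      omega
    · intro x hx x1 x0 x2
      obtain ⟨y, hy, y1, y0, y2, y3, y4⟩ := hE.exchange_one hδ hx (by omega)
      have := hmax' y hy (by omega) (by omega)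
      omega
    · intro x hx x2 x0 x1
      have := h x hx x2 x0
      omega
    · intro x hx x0 x1 x2
      obtain ⟨y, hy, y0, y1, y2, -, y4⟩ := hE.exchange_zero hδ hx (by omega)
      have := h y hy (by omega) (by omega)
      omega
    · intro x hx x0 x2
      have := hmax' x hx x0 x2
      omega
    · intro x hx x1 x2 x0
      have := h x hx x2 x0
      omega

/-- A corner with nothing to its right is the last column of its slice, which exists, and is unique,
exactly when the first coordinate is bounded. -/
theorem image_corners_unbounded_fst (hE : IsGoodSet E α γ) :
    Set.BijOn Prod.snd {q ∈ corners E γ | ¬ ∃ β ∈ E, β 2 = q.2 ∧ q.1 < β 0}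
      (boundedHeights E γ 0 2) := by
  refine ⟨?_, ?_, ?_⟩
  · rintro q ⟨hq, h⟩
    refine ⟨hq.1.1, fun β hβ h2 => ?_⟩
    by_contra! hc
    have := hE.corners_fst_lt hq
    exact h ⟨β, hβ, h2, by omega⟩
  · rintro ⟨a, n⟩ ⟨hq, h⟩ ⟨a', n'⟩ ⟨hq', h'⟩ (rfl : n = n')
    obtain ⟨-, β, hβ, rfl, h2, -⟩ := hq
    obtain ⟨-, β', hβ', rfl, h2', -⟩ := hq'
    simp only at h h' h2 h2'
    have h3 : ¬ β 0 < β' 0 := fun hc => h ⟨β', hβ', h2', hc⟩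
    have h4 : ¬ β' 0 < β 0 := fun hc => h' ⟨β, hβ, h2, hc⟩
    rw [Prod.mk.injEq]
    exact ⟨by omega, rfl⟩
  · rintro n ⟨⟨β, hβ, rfl⟩, h⟩
    obtain ⟨_, ⟨δ, ⟨hδ, h5⟩, rfl⟩, hmax⟩ := exists_max_of_bounded
      (S := (fun β => β 0) '' {x | x ∈ E ∧ x 2 = β 2}) ⟨_, β, ⟨hβ, rfl⟩, rfl⟩
      (b := γ 0) (by rintro _ ⟨β', ⟨hβ', h'⟩, rfl⟩; exact h β' hβ' h')
    have hmax' : ∀ x ∈ E, x 2 = β 2 → ¬ δ 0 < x 0 := fun x hx h' =>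
      (hmax _ ⟨x, ⟨hx, h'⟩, rfl⟩).not_gt
    refine ⟨(δ 0, β 2), ⟨⟨⟨⟨β, hβ, rfl⟩, fun x hx h2 h0 => ?_⟩, δ, hδ, rfl, h5,
      fun x hx x2 x0 => ?_⟩, ?_⟩, rfl⟩
    · have := h x hx h2
      omega
    · exact absurd x0 (hmax' x hx x2)
    · rintro ⟨x, hx, x2, x0⟩
      exact hmax' x hx x2 x0

/-- No corner lies to the left of an unbounded column at the same height, so a slice has at most one
unbounded corner column: the rightmost column reaching `γ 1`. -/
theorem image_corners_unbounded_snd (hE : IsGoodSet E α γ) :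
    Set.BijOn Prod.snd {q ∈ corners E γ | ¬ ∀ β ∈ E, β 0 = q.1 → β 2 = q.2 → β 1 < γ 1}
      (jointlyBoundedHeights E γ \ boundedHeights E γ 1 2) := by
  refine ⟨?_, ?_, ?_⟩
  · rintro q ⟨hq, h⟩
    refine ⟨hq.1, fun h' => h fun β hβ h0 h2 => h'.2 β hβ h2⟩
  · have key : ∀ q ∈ corners E γ, ∀ q' : ℤ × ℤ,
        (¬ ∀ β ∈ E, β 0 = q'.1 → β 2 = q'.2 → β 1 < γ 1) → q.2 = q'.2 → ¬ q.1 < q'.1 := by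
      rintro q ⟨-, β, hβ, h0, h2, h⟩ q' h' e hlt
      push Not at h'
      obtain ⟨δ, hδ, d0, d2, d1⟩ := h'
      obtain ⟨ε, hε, e1, e2⟩ := hE.raise hδ d1 (β 1)
      have := h ε hε (by rw [e2 2 (by simp), d2, e]) (by rw [e2 0 (by simp)]; omega)
      omega
    rintro q ⟨hq, h⟩ q' ⟨hq', h'⟩ e
    have h1 := key q hq q' h' e
    have h2 := key q' hq' q h e.symm
    exact Prod.ext (by omega) e
  · rintro n ⟨hn, h⟩
    have h' : ∃ β ∈ E, β 2 = n ∧ γ 1 ≤ β 1 := by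
      by_contra! hc
      exact h ⟨hn.1, hc⟩
    obtain ⟨β, hβ, h2, h1⟩ := h'
    obtain ⟨_, ⟨δ, ⟨hδ, h5, h6⟩, rfl⟩, hmax⟩ := exists_max_of_bounded
      (S := (fun β => β 0) '' {x | x ∈ E ∧ x 2 = n ∧ γ 1 ≤ x 1}) ⟨_, β, ⟨hβ, h2, h1⟩, rfl⟩
      (b := γ 0) (by
        rintro _ ⟨x, ⟨hx, x2, x1⟩, rfl⟩
        by_contra! hc
        have := hn.2 x hx x2 hc
        omega)
    refine ⟨(δ 0, n), ⟨⟨hn, δ, hδ, rfl, h5, fun x hx x2 x0 => ?_⟩, ?_⟩, rfl⟩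
    · by_contra! hc
      have := hmax _ ⟨x, ⟨hx, x2, by omega⟩, rfl⟩
      simp only at this x0
      omega
    · intro hc
      have := hc δ hδ rfl h5
      omega

/-- If coordinate `i` had reached `γ i`, exchanging `β` with a copy raised at `i` would lift `k`,
keep `i` and not lower `j`. The result lies in the fiber of `{i}` or, after another raise at `i`, in
that of `{j}`. -/
theorem maximals_lt (hE : IsGoodSet E α γ) {β : Fin 3 → ℤ} (hβ : β ∈ maximals E) (i : Fin 3) :
    β i < γ i := by
  obtain ⟨hβE, hmax⟩ := hβ
  obtain ⟨j, k, hij, hik, hjk, hl⟩ : ∃ j k : Fin 3, i ≠ j ∧ i ≠ k ∧ j ≠ k ∧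
      ∀ l, l = i ∨ l = j ∨ l = k := by
    revert i; decide
  by_contra! hc
  obtain ⟨δ, hδ, h1, h2⟩ := hE.raise hβE hc (β i + 1)
  obtain ⟨ε, hε, h3, h4⟩ := hE.exchange β hβE δ hδ k (h2 k hik.symm).symm
  have h5 := (h4 i).2 (by omega)
  have h6 := (h4 j).1
  rw [h2 j hij.symm, min_self] at h6
  rcases h6.lt_or_eq with h6 | h6
  · have : ε ∈ fiber E {i} β := ⟨hε, by rintro l rfl; omega, fun l hli => by
      rcases hl l with rfl | rfl | rfl
      exacts [absurd rfl hli, h6, h3]⟩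
    rw [hmax] at this
    exact this
  · obtain ⟨ζ, hζ, h7, h8⟩ := hE.raise hε (i := i) (by omega) (β i + 1)
    have : ζ ∈ fiber E {j} β := ⟨hζ, by rintro l rfl; rw [h8 l hij.symm, h6], fun l hli => by
      rcases hl l with rfl | rfl | rfl
      exacts [by omega, absurd rfl hli, by rw [h8 l hik.symm]; exact h3]⟩
    rw [hmax] at this
    exact this

theorem maximals_finite (hE : IsGoodSet E α γ) : (maximals E).Finite :=
  (Set.finite_Icc α γ).subset fun _ hβ =>
    ⟨hE.lower _ hβ.1, fun i => (hE.maximals_lt hβ i).le⟩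

theorem ncard_sep_add {X : Type*} {S : Set X} (hS : S.Finite) (P : X → Prop) :
    {x ∈ S | P x}.ncard + {x ∈ S | ¬ P x}.ncard = S.ncard := by
  rw [← Set.ncard_union_eq _ (hS.subset (Set.sep_subset _ _)) (hS.subset (Set.sep_subset _ _))]
  · congr 1
    ext x
    simp only [Set.mem_union, Set.mem_ofPred_eq]
    tauto
  · rw [Set.disjoint_left]
    rintro x ⟨_, h⟩ ⟨_, h'⟩
    exact h' h

theorem boundedHeights_one_two_subset :
    boundedHeights E γ 1 2 ⊆ jointlyBoundedHeights E γ :=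
  fun _ h => ⟨h.1, fun β hβ h2 _ => h.2 β hβ h2⟩

/-- The number of relative and absolute maximals of a good set. -/
theorem ncard_jointlyBoundedHeights (hE : IsGoodSet E α γ) :
    (jointlyBoundedHeights E γ).ncard + (absMaximals E).ncard =
      (boundedHeights E γ 0 2).ncard + (boundedHeights E γ 1 2).ncard +
        (relMaximals E).ncard := by
  -- The double count of the corners: by whether the slice continues to their right, and by whether
  -- their column is bounded.
  have h1 := ncard_sep_add hE.corners_finite (fun q => ∃ β ∈ E, β 2 = q.2 ∧ q.1 < β 0)
  have h2 := ncard_sep_add hE.corners_finite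
    (fun q => ∀ β ∈ E, β 0 = q.1 → β 2 = q.2 → β 1 < γ 1)
  rw [← hE.image_relMaximals, injOn_relMaximals.ncard_image,
    hE.image_corners_unbounded_fst.ncard_eq] at h1
  rw [← hE.image_absMaximals, injOn_absMaximals.ncard_image,
    hE.image_corners_unbounded_snd.ncard_eq] at h2
  have h3 := Set.ncard_sdiff_add_ncard_of_subset (boundedHeights_one_two_subset (E := E) (γ := γ))
    hE.jointlyBoundedHeights_finite
  omega

end IsGoodSet

/-! ### Lengths of subquotients -/

section Length

variable {R K : Type*} [CommRing R] [AddCommGroup K] [Module R K]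

/-- The length of the subquotient `N / N'`. -/
noncomputable def relLength (N' N : Submodule R K) : ℕ∞ :=
  Module.length R (N ⧸ N'.submoduleOf N)

theorem relLength_self (N : Submodule R K) : relLength N N = 0 := by
  rw [relLength, Module.length_eq_zero_iff, Submodule.submoduleOf_self]
  infer_instance

theorem relLength_add {N₁ N₂ N₃ : Submodule R K} (h₁ : N₁ ≤ N₂) (h₂ : N₂ ≤ N₃) :
    relLength N₁ N₃ = relLength N₁ N₂ + relLength N₂ N₃ := by
  let f : (N₂ ⧸ N₁.submoduleOf N₂) →ₗ[R] (N₃ ⧸ N₁.submoduleOf N₃) :=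
    Submodule.mapQ _ _ (Submodule.inclusion h₂) fun x hx => hx
  let g : (N₃ ⧸ N₁.submoduleOf N₃) →ₗ[R] (N₃ ⧸ N₂.submoduleOf N₃) :=
    Submodule.mapQ _ _ LinearMap.id fun x hx => h₁ hx
  refine Module.length_eq_add_of_exact f g ?_ ?_ ?_
  · rw [← LinearMap.ker_eq_bot, LinearMap.ker_eq_bot']
    intro x hx
    obtain ⟨x, rfl⟩ := Submodule.Quotient.mk_surjective _ x
    have hx' : Submodule.inclusion h₂ x ∈ N₁.submoduleOf N₃ :=
      (Submodule.Quotient.mk_eq_zero _).1 hx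
    exact (Submodule.Quotient.mk_eq_zero _).2 hx'
  · intro x
    obtain ⟨x, rfl⟩ := Submodule.Quotient.mk_surjective _ x
    exact ⟨Submodule.Quotient.mk x, rfl⟩
  · intro x
    obtain ⟨x, rfl⟩ := Submodule.Quotient.mk_surjective _ x
    constructor
    · intro hx
      have hx' : x ∈ N₂.submoduleOf N₃ := (Submodule.Quotient.mk_eq_zero _).1 hx
      exact ⟨Submodule.Quotient.mk ⟨x, hx'⟩, rfl⟩
    · rintro ⟨y, hy⟩
      obtain ⟨y, rfl⟩ := Submodule.Quotient.mk_surjective _ y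
      have hy' : (y : K) - x ∈ N₁ := (Submodule.Quotient.eq (N₁.submoduleOf N₃)).1 hy
      have hx' := N₂.sub_mem y.2 (h₁ hy')
      rw [sub_sub_cancel] at hx'
      exact (Submodule.Quotient.mk_eq_zero (p := N₂.submoduleOf N₃)).2 hx'

theorem relLength_eq_one {N' N : Submodule R K} (h : ∃ x ∈ N, x ∉ N')
    (hs : ∀ x ∈ N, ∀ y ∈ N, y ∉ N' → ∃ r : R, x - r • y ∈ N') : relLength N' N = 1 := by
  rw [relLength, Module.length_eq_one_iff, isSimpleModule_iff_toSpanSingleton_surjective]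
  obtain ⟨z, hz, hz'⟩ := h
  refine ⟨⟨Submodule.Quotient.mk ⟨z, hz⟩, 0, fun h => hz' ?_⟩, fun y hy x => ?_⟩
  · rw [Submodule.Quotient.mk_eq_zero] at h
    exact h
  · obtain ⟨x, rfl⟩ := Submodule.Quotient.mk_surjective _ x
    obtain ⟨y, rfl⟩ := Submodule.Quotient.mk_surjective _ y
    obtain ⟨r, hr⟩ := hs x x.2 y y.2 fun h => hy ((Submodule.Quotient.mk_eq_zero _).2 h)
    refine ⟨r, ?_⟩
    rw [LinearMap.toSpanSingleton_apply, ← Submodule.Quotient.mk_smul, eq_comm,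
      Submodule.Quotient.eq]
    exact hr

end Length

/-! ### Filtrations by values -/

/-- A family of decreasing filtrations of an `R`-module whose graded pieces are at most
one-dimensional over the residue field and which are independent of each other. -/
structure IsValueFiltration {R K ι : Type*} [CommRing R] [IsLocalRing R] [AddCommGroup K]
    [Module R K] (F : ι → ℤ → Submodule R K) : Prop where
  antitone : ∀ i, Antitone (F i)
  exists_sub_smul_mem : ∀ i n, ∀ h ∈ F i n, ∀ h' ∈ F i n, h' ∉ F i (n + 1) →
    ∃ r : R, h - r • h' ∈ F i (n + 1)
  smul_mem_succ : ∀ i n, ∀ r ∈ IsLocalRing.maximalIdeal R, ∀ h ∈ F i n, r • h ∈ F i (n + 1)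
  exists_value : ∀ α : ι → ℤ, ∃ h, ∀ i, h ∈ F i (α i) ∧ h ∉ F i (α i + 1)

/-- The vectors of values of the elements of a submodule. -/
def filtValues {R K ι : Type*} [CommRing R] [AddCommGroup K] [Module R K]
    (F : ι → ℤ → Submodule R K) (N : Submodule R K) : Set (ι → ℤ) :=
  {β | ∃ h ∈ N, ∀ i, h ∈ F i (β i) ∧ h ∉ F i (β i + 1)}

namespace IsValueFiltration

variable {R K ι : Type*} [CommRing R] [IsLocalRing R] [AddCommGroup K] [Module R K]
  {F : ι → ℤ → Submodule R K} {N : Submodule R K} {α γ : ι → ℤ}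

theorem value_unique (hF : IsValueFiltration F) {i : ι} {h : K} {m n : ℤ}
    (hm : h ∉ F i (m + 1)) (hn : h ∈ F i n) : n ≤ m := by
  by_contra! hc
  exact hm (hF.antitone i (by omega) hn)

/-- The second alternative is the value infinity, taken by elements that vanish on a branch. -/
theorem value_or (hF : IsValueFiltration F) {i : ι} {h : K} {a : ℤ} (ha : h ∈ F i a) :
    (∃ n, h ∈ F i n ∧ h ∉ F i (n + 1)) ∨ ∀ n, h ∈ F i n := by
  by_cases hall : ∀ n, h ∈ F i n
  · exact Or.inr hall
  · push Not at hall
    obtain ⟨n, hn⟩ := hall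
    obtain ⟨m, hm, hm'⟩ := exists_min_of_bounded (S := {n | h ∉ F i n}) ⟨n, hn⟩ (b := a) (by
      intro x hx
      by_contra! hc
      exact hx (hF.antitone i hc.le ha))
    refine Or.inl ⟨m - 1, ?_, by simpa using hm⟩
    by_contra hc
    have := hm' _ hc
    omega

/-- An element of `N` can be perturbed to have a value in every direction. -/
theorem exists_filtValues (hF : IsValueFiltration F) (hα : ∀ h ∈ N, ∀ i, h ∈ F i (α i))
    (hγ : ∀ h, (∀ i, h ∈ F i (γ i)) → h ∈ N) {h : K} (hh : h ∈ N) (δ : ι → ℤ) :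
    ∃ β ∈ filtValues F N, (∀ i n, h ∈ F i n → h ∉ F i (n + 1) → β i = n) ∧
      ∀ i, h ∈ F i (δ i) → δ i ≤ β i := by
  -- `e` will be the value of the perturbation `g`. It is at least `γ i` to keep `g` in `N`, and
  -- exceeds a finite value of `h`, leaving it unchanged. Where `h` has value infinity, `e` becomes
  -- the new value and is taken at least `δ i`.
  have h1 : ∀ i, ∃ e n : ℤ, γ i ≤ e ∧ (∀ g, g ∈ F i e → g ∉ F i (e + 1) →
      h + g ∈ F i n ∧ h + g ∉ F i (n + 1)) ∧ (∀ m, h ∈ F i m → h ∉ F i (m + 1) → n = m) ∧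
      (h ∈ F i (δ i) → δ i ≤ n) := by
    intro i
    rcases hF.value_or (hα h hh i) with ⟨n, hn, hn'⟩ | hall
    · refine ⟨max (γ i) (n + 1), n, le_max_left _ _, fun g hg _ => ?_, fun m hm hm' => ?_,
        fun hd => hF.value_unique hn' hd⟩
      · have hg1 := hF.antitone i (le_max_right (γ i) (n + 1)) hg
        refine ⟨(F i n).add_mem hn (hF.antitone i (by omega) hg1), fun hc => hn' ?_⟩
        simpa using (F i (n + 1)).sub_mem hc hg1
      · exact (hF.value_unique hm' hn).antisymm (hF.value_unique hn' hm)
    · refine ⟨max (γ i) (δ i), max (γ i) (δ i), le_max_left _ _, fun g hg hg' => ?_,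
        fun m _ hm' => absurd (hall _) hm', fun _ => le_max_right _ _⟩
      refine ⟨(F i _).add_mem (hall _) hg, fun hc => hg' ?_⟩
      simpa using (F i _).sub_mem hc (hall _)
  choose e n he h2 h3 h4 using h1
  obtain ⟨g, hg⟩ := hF.exists_value e
  refine ⟨n, ⟨h + g, N.add_mem hh (hγ g fun i => hF.antitone i (he i) (hg i).1), fun i =>
    h2 i g (hg i).1 (hg i).2⟩, h3, h4⟩

/-- A nonunit `r` would push `r • h'`, and with it `h`, one step deeper. -/
theorem isUnit_of_sub_smul_mem (hF : IsValueFiltration F) {i : ι} {n : ℤ} {h h' : K} {r : R}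
    (hh : h ∉ F i (n + 1)) (hh' : h' ∈ F i n) (hr : h - r • h' ∈ F i (n + 1)) : IsUnit r := by
  by_contra hu
  exact hh (by simpa using
    (F i (n + 1)).add_mem hr (hF.smul_mem_succ i n r ((IsLocalRing.mem_maximalIdeal r).2 hu) h' hh'))

theorem add_unit_smul (hF : IsValueFiltration F) {i : ι} {m n : ℤ} {h h' : K} {u : R}
    (hu : IsUnit u) (hh : h ∈ F i m ∧ h ∉ F i (m + 1)) (hh' : h' ∈ F i n ∧ h' ∉ F i (n + 1)) :
    h + u • h' ∈ F i (min m n) ∧ (m ≠ n → h + u • h' ∉ F i (min m n + 1)) := by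
  have hsm : ∀ k, u • h' ∈ F i k ↔ h' ∈ F i k := fun k =>
    (F i k).smul_mem_iff_of_isUnit hu
  refine ⟨(F i _).add_mem (hF.antitone i (min_le_left _ _) hh.1)
    ((hsm _).2 (hF.antitone i (min_le_right _ _) hh'.1)), fun hmn hc => ?_⟩
  rcases lt_or_gt_of_ne hmn with hlt | hlt
  · rw [min_eq_left hlt.le] at hc
    refine hh.2 ?_
    have := (F i (m + 1)).sub_mem hc ((hsm _).2 (hF.antitone i (by omega) hh'.1))
    simpa using this
  · rw [min_eq_right hlt.le] at hc
    refine hh'.2 ((hsm _).1 ?_)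
    have := (F i (n + 1)).sub_mem hc (hF.antitone i (by omega) hh.1)
    simpa using this

/-- Cancel the leading terms in direction `i` with a unit coefficient. Elsewhere the ultrametric
inequality holds, sharp where the values differ; a perturbation makes all values finite. -/
theorem exchange (hF : IsValueFiltration F) (hα : ∀ h ∈ N, ∀ i, h ∈ F i (α i))
    (hγ : ∀ h, (∀ i, h ∈ F i (γ i)) → h ∈ N) {β β' : ι → ℤ} (hβ : β ∈ filtValues F N)
    (hβ' : β' ∈ filtValues F N) {i : ι} (hi : β i = β' i) : ∃ ε ∈ filtValues F N, β i < ε i ∧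
    ∀ j, min (β j) (β' j) ≤ ε j ∧ (β j ≠ β' j → ε j = min (β j) (β' j)) := by
  classical
  obtain ⟨h, hh, hv⟩ := hβ
  obtain ⟨h', hh', hv'⟩ := hβ'
  obtain ⟨r, hr⟩ := hF.exists_sub_smul_mem i (β i) h (hv i).1 h' (hi ▸ (hv' i).1)
    (hi ▸ (hv' i).2)
  have hu := hF.isUnit_of_sub_smul_mem (hv i).2 (hi ▸ (hv' i).1) hr
  have hsum : h - r • h' = h + (-r) • h' := by rw [neg_smul, sub_eq_add_neg]
  obtain ⟨ε, hε, h1, h2⟩ := hF.exists_filtValues hα hγ (N.sub_mem hh (N.smul_mem r hh'))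
    (fun j => if j = i then β i + 1 else min (β j) (β' j))
  have h3 := fun j => hF.add_unit_smul hu.neg (hv j) (hv' j)
  rw [hsum] at h1 h2 hr
  have h4 : β i < ε i := by
    have := h2 i (by simpa using hr)
    simp at this
    omega
  refine ⟨ε, hε, h4, fun j => ⟨?_, fun hne => h1 j _ (h3 j).1 ((h3 j).2 hne)⟩⟩
  by_cases hj : j = i
  · subst hj; omega
  · have := h2 j (by simpa [hj] using (h3 j).1)
    simpa [hj] using this

/-- Stability under infima, for three directions: at most one direction needs a choice of a
residue class, so that two classes of units suffice. -/
theorem inf_mem {F : Fin 3 → ℤ → Submodule R K} (hF : IsValueFiltration F)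
    (hu : ∃ u : R, IsUnit u ∧ IsUnit (1 - u))
    {β β' : Fin 3 → ℤ} (hβ : β ∈ filtValues F N)
    (hβ' : β' ∈ filtValues F N) : β ⊓ β' ∈ filtValues F N := by
  by_cases hle : β ≤ β'
  · rwa [inf_eq_left.2 hle]
  by_cases hle' : β' ≤ β
  · rwa [inf_eq_right.2 hle']
  obtain ⟨h, hh, hv⟩ := hβ
  obtain ⟨h', hh', hv'⟩ := hβ'
  obtain ⟨u, hu, hu'⟩ := hu
  have h1 := fun i => hF.add_unit_smul isUnit_one (hv i) (hv' i)
  have h2 := fun i => hF.add_unit_smul hu (hv i) (hv' i)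
  have hmem : ∀ v : R, h + v • h' ∈ N := fun v => N.add_mem hh (N.smul_mem v hh')
  rw [Pi.le_def] at hle hle'
  push Not at hle hle'
  obtain ⟨j, hj⟩ := hle
  obtain ⟨k, hk⟩ := hle'
  have hjk : j ≠ k := by rintro rfl; omega
  obtain ⟨l, hl⟩ : ∃ l, ∀ x : Fin 3, x = j ∨ x = k ∨ x = l := by
    clear hj hk
    revert j k
    decide
  by_cases hcl : h + (1 : R) • h' ∈ F l (min (β l) (β' l) + 1)
  · refine ⟨h + u • h', hmem u, fun i => ⟨(h2 i).1, ?_⟩⟩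
    rcases hl i with rfl | rfl | rfl
    · exact (h2 _).2 (by omega)
    · exact (h2 _).2 (by omega)
    · by_cases hne : β i = β' i
      · intro hc
        -- Were both combinations too deep in the tied direction, so would be their difference `(1 -
        -- u) • h'`, although `1 - u` is a unit.
        have h3 := (F i _).sub_mem hcl hc
        rw [add_sub_add_left_eq_sub, ← sub_smul,
          (F i _).smul_mem_iff_of_isUnit hu', ← hne, min_self] at h3
        exact (hv' i).2 (hne ▸ h3)
      · exact (h2 _).2 hne
  · refine ⟨h + (1 : R) • h', hmem 1, fun i => ⟨(h1 i).1, ?_⟩⟩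
    rcases hl i with rfl | rfl | rfl
    · exact (h1 _).2 (by omega)
    · exact (h1 _).2 (by omega)
    · exact hcl

theorem isGoodSet {F : Fin 3 → ℤ → Submodule R K} {α γ : Fin 3 → ℤ} (hF : IsValueFiltration F)
    (hα : ∀ h ∈ N, ∀ i, h ∈ F i (α i))
    (hγ : ∀ h, (∀ i, h ∈ F i (γ i)) → h ∈ N) (hu : ∃ u : R, IsUnit u ∧ IsUnit (1 - u)) :
    IsGoodSet (filtValues F N) α γ where
  inf_mem _ hβ _ hβ' := hF.inf_mem hu hβ hβ'
  exchange _ hβ _ hβ' _ hi := hF.exchange hα hγ hβ hβ' hi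
  lower := by
    rintro β ⟨h, hh, hv⟩ i
    exact hF.value_unique (hv i).2 (hα h hh i)
  conductor := by
    intro β hβ
    obtain ⟨h, hv⟩ := hF.exists_value β
    exact ⟨h, hγ h fun i => hF.antitone i (hβ i) (hv i).1, hv⟩

/-- Passing from `b` to `b + 1` adds one to the length if `N` attains the value `b`, and nothing
otherwise. -/
theorem relLength_inf (hF : IsValueFiltration F) (i : ι) {a b : ℤ} (hab : a ≤ b)
    (hN : N ≤ F i a) : {n | n < b ∧ ∃ h ∈ N, h ∈ F i n ∧ h ∉ F i (n + 1)}.Finite ∧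
    relLength (N ⊓ F i b) N =
      ({n | n < b ∧ ∃ h ∈ N, h ∈ F i n ∧ h ∉ F i (n + 1)}.ncard : ℕ∞) := by
  induction b, hab using Int.leInduction with
  | base =>
    have hempty : {n | n < a ∧ ∃ h ∈ N, h ∈ F i n ∧ h ∉ F i (n + 1)} = ∅ := by
      rw [Set.eq_empty_iff_forall_notMem]
      rintro n ⟨hn, h, hh, -, h2⟩
      exact h2 (hF.antitone i (by omega) (hN hh))
    rw [hempty, inf_eq_left.2 hN, relLength_self]
    simp
  | succ b hab ih =>
    obtain ⟨hfin, hlen⟩ := ih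
    rw [relLength_add (N₂ := N ⊓ F i b)
      (inf_le_inf_left N (hF.antitone i (by omega))) inf_le_left, hlen]
    by_cases hex : ∃ h ∈ N, h ∈ F i b ∧ h ∉ F i (b + 1)
    · have hset : {n | n < b + 1 ∧ ∃ h ∈ N, h ∈ F i n ∧ h ∉ F i (n + 1)} =
          insert b {n | n < b ∧ ∃ h ∈ N, h ∈ F i n ∧ h ∉ F i (n + 1)} := by
        ext n
        simp only [Set.mem_insert_iff, Set.mem_ofPred_eq]
        constructor
        · rintro ⟨hn, h⟩
          rcases (by omega : n < b ∨ n = b) with h' | h'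
          exacts [Or.inr ⟨h', h⟩, Or.inl h']
        · rintro (rfl | ⟨hn, h⟩)
          exacts [⟨by omega, hex⟩, ⟨by omega, h⟩]
      rw [hset, Set.ncard_insert_of_notMem (by simp) hfin]
      refine ⟨hfin.insert b, ?_⟩
      rw [relLength_eq_one, add_comm]
      · norm_cast
      · obtain ⟨h, h1, h2, h3⟩ := hex
        exact ⟨h, ⟨h1, h2⟩, fun h => h3 h.2⟩
      · rintro x ⟨hx, hx'⟩ y ⟨hy, hy'⟩ hy2
        obtain ⟨r, hr⟩ := hF.exists_sub_smul_mem i b x hx' y hy' fun hc => hy2 ⟨hy, hc⟩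
        exact ⟨r, N.sub_mem hx (N.smul_mem r hy), hr⟩
    · have hset : {n | n < b + 1 ∧ ∃ h ∈ N, h ∈ F i n ∧ h ∉ F i (n + 1)} =
          {n | n < b ∧ ∃ h ∈ N, h ∈ F i n ∧ h ∉ F i (n + 1)} := by
        ext n
        simp only [Set.mem_ofPred_eq]
        refine ⟨fun ⟨hn, h⟩ => ⟨lt_of_le_of_ne (by omega) ?_, h⟩, fun ⟨hn, h⟩ => ⟨by omega, h⟩⟩
        rintro rfl
        exact hex h
      have heq : N ⊓ F i (b + 1) = N ⊓ F i b := by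
        refine (inf_le_inf_left N (hF.antitone i (by omega))).antisymm fun x hx => ⟨hx.1, ?_⟩
        by_contra hc
        exact hex ⟨x, hx.1, hx.2, hc⟩
      rw [hset, heq, relLength_self, zero_add]
      exact ⟨hfin, rfl⟩

/-- The colength of the conductor in terms of the value set. -/
theorem relLength_conductor {F : Fin 3 → ℤ → Submodule R K} {α γ : Fin 3 → ℤ}
    (hF : IsValueFiltration F) (hα : ∀ h ∈ N, ∀ i, h ∈ F i (α i))
    (hγ : ∀ h, (∀ i, h ∈ F i (γ i)) → h ∈ N) (hu : ∃ u : R, IsUnit u ∧ IsUnit (1 - u))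
    {m : Fin 3 → ℤ} (hm : IsLeast (filtValues F N) m) :
    ∃ l : ℕ, relLength (⨅ i, F i (γ i)) N = l ∧
      (l : ℤ) + ∑ i, ((gaps {n | ∃ β ∈ filtValues F N, β i = n}).ncard : ℤ) +
        (boundedHeights (filtValues F N) γ 0 1).ncard +
        (boundedHeights (filtValues F N) γ 0 2).ncard +
        (boundedHeights (filtValues F N) γ 1 2).ncard + (relMaximals (filtValues F N)).ncard =
      ∑ i, (γ i - m i) + (absMaximals (filtValues F N)).ncard := by
  set E := filtValues F N with hEdef
  have hE : IsGoodSet E α γ := hF.isGoodSet hα hγ hu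
  have hαm : ∀ i, α i ≤ m i := hE.lower m hm.1
  have hαγ : ∀ i, α i ≤ γ i := hE.lower γ (hE.conductor γ le_rfl)
  have hval : ∀ h ∈ N, ∀ i n, h ∈ F i n → h ∉ F i (n + 1) → ∃ β ∈ E, β i = n ∧
      ∀ j, h ∈ F j (γ j) → γ j ≤ β j := by
    intro h hh i n hn hn'
    obtain ⟨β, hβ, h1, h2⟩ := hF.exists_filtValues hα hγ hh γ
    exact ⟨β, hβ, h1 i n hn hn', h2⟩
  obtain ⟨hf0, hl0⟩ := hF.relLength_inf (N := N) 0 (hαγ 0) fun h hh => hα h hh 0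
  obtain ⟨hf1, hl1⟩ := hF.relLength_inf (N := N ⊓ F 0 (γ 0)) 1 (hαγ 1) fun h hh => hα h hh.1 1
  obtain ⟨hf2, hl2⟩ := hF.relLength_inf (N := N ⊓ F 0 (γ 0) ⊓ F 1 (γ 1)) 2 (hαγ 2)
    fun h hh => hα h hh.1.1 2
  have hinf : N ⊓ F 0 (γ 0) ⊓ F 1 (γ 1) ⊓ F 2 (γ 2) = ⨅ i, F i (γ i) := by
    ext h
    simp only [Submodule.mem_inf, Submodule.mem_iInf]
    constructor
    · rintro ⟨⟨⟨-, h0⟩, h1⟩, h2⟩ i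
      fin_cases i
      exacts [h0, h1, h2]
    · exact fun h' => ⟨⟨⟨hγ h h', h' 0⟩, h' 1⟩, h' 2⟩
  have hs0 : {n | n < γ 0 ∧ ∃ h ∈ N, h ∈ F 0 n ∧ h ∉ F 0 (n + 1)} =
      {n | n < γ 0 ∧ ∃ β ∈ E, β 0 = n} := by
    ext n
    refine and_congr_right fun _ => ⟨?_, ?_⟩
    · rintro ⟨h, hh, h1, h2⟩
      obtain ⟨β, hβ, h3, -⟩ := hval h hh 0 n h1 h2
      exact ⟨β, hβ, h3⟩
    · rintro ⟨β, ⟨h, hh, hv⟩, rfl⟩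
      exact ⟨h, hh, hv 0⟩
  -- Below `γ 1`, a height survives the first cut unless direction 0 is bounded there.
  have hs1 : {n | n < γ 1 ∧ ∃ h ∈ N ⊓ F 0 (γ 0), h ∈ F 1 n ∧ h ∉ F 1 (n + 1)} =
      {n | n < γ 1 ∧ ∃ β ∈ E, β 1 = n} \ boundedHeights E γ 0 1 := by
    ext n
    constructor
    · rintro ⟨hn, h, ⟨hh, h0⟩, h1, h2⟩
      obtain ⟨β, hβ, h3, h4⟩ := hval h hh 1 n h1 h2
      exact ⟨⟨hn, β, hβ, h3⟩, fun hc => (hc.2 β hβ h3).not_ge (h4 0 h0)⟩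
    · rintro ⟨⟨hn, hex⟩, hc⟩
      have : ∃ β ∈ E, β 1 = n ∧ γ 0 ≤ β 0 := by
        by_contra! h
        exact hc ⟨hex, h⟩
      obtain ⟨β, ⟨h, hh, hv⟩, rfl, h0⟩ := this
      exact ⟨hn, h, ⟨hh, hF.antitone 0 h0 (hv 0).1⟩, hv 1⟩
  -- Likewise a height survives both cuts unless directions 0 and 1 are jointly bounded there.
  have hs2 : {n | n < γ 2 ∧ ∃ h ∈ N ⊓ F 0 (γ 0) ⊓ F 1 (γ 1), h ∈ F 2 n ∧ h ∉ F 2 (n + 1)} =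
      {n | n < γ 2 ∧ ∃ β ∈ E, β 2 = n} \ IsGoodSet.jointlyBoundedHeights E γ := by
    ext n
    constructor
    · rintro ⟨hn, h, ⟨⟨hh, h0⟩, h0'⟩, h1, h2⟩
      obtain ⟨β, hβ, h3, h4⟩ := hval h hh 2 n h1 h2
      exact ⟨⟨hn, β, hβ, h3⟩, fun hc => (hc.2 β hβ h3 (h4 0 h0)).not_ge (h4 1 h0')⟩
    · rintro ⟨⟨hn, hex⟩, hc⟩
      have : ∃ β ∈ E, β 2 = n ∧ γ 0 ≤ β 0 ∧ γ 1 ≤ β 1 := by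
        by_contra! h
        exact hc ⟨hex, h⟩
      obtain ⟨β, ⟨h, hh, hv⟩, rfl, h0, h1⟩ := this
      exact ⟨hn, h, ⟨⟨hh, hF.antitone 0 h0 (hv 0).1⟩, hF.antitone 1 h1 (hv 1).1⟩, hv 2⟩
  -- Counting gaps needs the actual minimum as lower bound, not just some `α`.
  have hE' := hE.lower_of_isLeast hm
  have hb1 : boundedHeights E γ 0 1 ⊆ {n | n < γ 1 ∧ ∃ β ∈ E, β 1 = n} := fun n hn =>
    ⟨(hE.boundedHeights_subset (by simp) hn).2, hn.1⟩
  have hb2 : IsGoodSet.jointlyBoundedHeights E γ ⊆ {n | n < γ 2 ∧ ∃ β ∈ E, β 2 = n} :=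
    fun n hn => ⟨(hE.jointlyBoundedHeights_subset hn).2, hn.1⟩
  have hd1 := Set.ncard_sdiff_add_ncard_of_subset hb1
    ((Set.finite_Ico (m 1) (γ 1)).subset fun n ⟨hn, β, hβ, h⟩ => ⟨h ▸ hm.2 hβ 1, hn⟩)
  have hd2 := Set.ncard_sdiff_add_ncard_of_subset hb2
    ((Set.finite_Ico (m 2) (γ 2)).subset fun n ⟨hn, β, hβ, h⟩ => ⟨h ▸ hm.2 hβ 2, hn⟩)
  have g0 := (hE'.gaps_proj hm.1 0).2
  have g1 := (hE'.gaps_proj hm.1 1).2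
  have g2 := (hE'.gaps_proj hm.1 2).2
  have hcount := hE.ncard_jointlyBoundedHeights
  rw [hinf, hs2] at hl2
  rw [hs1] at hl1
  rw [hs0] at hl0
  have hlen := relLength_add (N₁ := ⨅ i, F i (γ i)) (N₂ := N ⊓ F 0 (γ 0)) (N₃ := N)
    (hinf ▸ inf_le_left.trans inf_le_left) inf_le_left
  rw [relLength_add (N₂ := N ⊓ F 0 (γ 0) ⊓ F 1 (γ 1)) (hinf ▸ inf_le_left) inf_le_left,
    hl0, hl1, hl2, ← Nat.cast_add, ← Nat.cast_add] at hlen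
  refine ⟨_, hlen, ?_⟩
  simp only [Fin.sum_univ_three]
  push_cast
  omega

end IsValueFiltration

/-! ### Integral closures of complete one-dimensional local domains -/

section Complete

open IsLocalRing

/-- For finite `M` the completion is a quotient of the tensor product of the completed ring with
`M`, and elements of the completed ring come from `R`. -/
theorem isPrecomplete_of_finite {R M : Type*} [CommRing R] [AddCommGroup M] [Module R M]
    (I : Ideal R) [IsPrecomplete I R] [Module.Finite R M] : IsPrecomplete I M := by
  rw [← AdicCompletion.of_surjective_iff]
  intro x
  obtain ⟨t, rfl⟩ := AdicCompletion.ofTensorProduct_surjective_of_finite I M x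
  induction t using TensorProduct.induction_on with
  | zero => exact ⟨0, by simp⟩
  | tmul a m =>
    obtain ⟨r, rfl⟩ := AdicCompletion.of_surjective I R a
    refine ⟨r • m, ?_⟩
    rw [map_smul, AdicCompletion.ofTensorProduct_tmul]
    ext n
    rfl
  | add s t hs ht =>
    obtain ⟨a, ha⟩ := hs
    obtain ⟨b, hb⟩ := ht
    exact ⟨a + b, by rw [map_add, map_add, ha, hb]⟩

theorem relLength_map {R K : Type*} [CommRing R] [AddCommGroup K] [Module R K]
    (e : K ≃ₗ[R] K) (N' N : Submodule R K) :
    relLength (N'.map (e : K →ₗ[R] K)) (N.map (e : K →ₗ[R] K)) = relLength N' N := by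
  refine (LinearEquiv.length_eq (Submodule.Quotient.equiv _ _ (e.submoduleMap N) ?_)).symm
  ext ⟨x, hx⟩
  constructor
  · rintro ⟨y, hy, h⟩
    exact ⟨y, hy, congrArg Subtype.val h⟩
  · rintro ⟨y, hy, h⟩
    obtain ⟨z, hz, h'⟩ := hx
    have : y = z := e.injective (h.trans h'.symm)
    subst this
    exact ⟨⟨y, hz⟩, hy, Subtype.ext h⟩

/-- Multiplication by a nonzero element of a field, as a linear automorphism. -/
noncomputable def mulEquiv (D : Type*) [CommRing D] {L : Type*} [Field L] [Algebra D L] {c : L}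
    (hc : c ≠ 0) : L ≃ₗ[D] L :=
  (LinearEquiv.smulOfNeZero L L c hc).restrictScalars D

variable {D : Type*} [CommRing D] [IsNoetherianRing D]
  [Ring.DimensionLEOne D]

/-- Primes of the quotient come from nonzero primes of `D`, which are maximal, so the quotient is
Artinian. -/
theorem length_quotient_span_ne_top {z : D} (hz : z ≠ 0) :
    Module.length D (D ⧸ Ideal.span {z}) ≠ ⊤ := by
  have h0 : Ring.KrullDimLE 0 (D ⧸ Ideal.span {z}) := by
    rw [Ring.krullDimLE_zero_iff]
    intro P hP
    have hc : (P.comap (Ideal.Quotient.mk (Ideal.span {z}))).IsMaximal := by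
      refine Ring.DimensionLEOne.maximalOfPrime (fun h => hz ?_) (Ideal.comap_isPrime _ P)
      rw [← Ideal.mem_bot, ← h, Ideal.mem_comap,
        Ideal.Quotient.eq_zero_iff_mem.2 (Ideal.mem_span_singleton_self z)]
      exact P.zero_mem
    have := Ideal.map_eq_top_or_isMaximal_of_surjective _
      (Ideal.Quotient.mk_surjective (I := Ideal.span {z})) hc
    rw [Ideal.map_comap_of_surjective _ Ideal.Quotient.mk_surjective] at this
    exact this.resolve_left hP.ne_top
  have : IsArtinianRing (D ⧸ Ideal.span {z}) := isArtinianRing_iff_isNoetherianRing_krullDimLE_zero.2 ⟨inferInstance, h0⟩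
  rw [Module.length_eq_of_surjective (S := D) (R := D ⧸ Ideal.span {z})
    Ideal.Quotient.mk_surjective]
  exact Module.length_ne_top

variable {L : Type*} [Field L] [Algebra D L]

theorem relLength_span_ne_top {z : D} (hz : z ≠ 0) :
    relLength (Submodule.span D {algebraMap D L z}) (Submodule.span D {(1 : L)}) ≠ ⊤ := by
  let f : D →ₗ[D] Submodule.span D {(1 : L)} :=
    LinearMap.toSpanSingleton D _ ⟨1, Submodule.mem_span_singleton_self 1⟩
  let g : (D ⧸ Ideal.span {z}) →ₗ[D] (Submodule.span D {(1 : L)} ⧸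
      (Submodule.span D {algebraMap D L z}).submoduleOf (Submodule.span D {(1 : L)})) :=
    Submodule.mapQ _ _ f (by
      intro x hx
      obtain ⟨y, rfl⟩ := Ideal.mem_span_singleton'.1 hx
      refine Submodule.mem_span_singleton.2 ⟨y, ?_⟩
      simp [f, Algebra.smul_def])
  refine ne_top_of_le_ne_top (length_quotient_span_ne_top hz)
    (Module.length_le_of_surjective g fun x => ?_)
  obtain ⟨⟨x, hx⟩, rfl⟩ := Submodule.Quotient.mk_surjective _ x
  obtain ⟨r, rfl⟩ := Submodule.mem_span_singleton.1 hx
  exact ⟨Submodule.Quotient.mk r, rfl⟩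

variable [IsDomain D] [IsFractionRing D L]

/-- `B / xB` has the same length as `D / xD` for every nonzero fractional ideal `B`. -/
theorem relLength_mul_le {x : D} (hx : algebraMap D L x ≠ 0) {B : Submodule D L} (hB : B.FG) :
    relLength (B.map (mulEquiv D hx : L →ₗ[D] L)) B ≤
      relLength (Submodule.span D {algebraMap D L x}) (Submodule.span D {(1 : L)}) := by
  rcases eq_or_ne B ⊥ with rfl | hne
  · rw [Submodule.map_bot, relLength_self]
    exact zero_le
  obtain ⟨s, rfl⟩ := hB
  obtain ⟨y, hy⟩ := IsLocalization.exist_integer_multiples_of_finset D⁰ s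
  have hy0 : algebraMap D L y ≠ 0 :=
    IsFractionRing.to_map_ne_zero_of_mem_nonZeroDivisors y.2
  obtain ⟨b, hb, hb0⟩ := Submodule.exists_mem_ne_zero_of_ne_bot hne
  set B := Submodule.span D (s : Set L)
  -- A common denominator `y` moves `B` into `T` without changing the length of `B / xB`.
  set C := B.map (mulEquiv D hy0 : L →ₗ[D] L)
  set T := Submodule.span D {(1 : L)}
  have hCT : C ≤ T := by
    rw [Submodule.map_le_iff_le_comap, Submodule.span_le]
    intro a ha
    obtain ⟨d, hd⟩ := hy a ha
    refine Submodule.mem_span_singleton.2 ⟨d, ?_⟩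
    rw [Algebra.smul_def, mul_one, hd]
    exact Algebra.smul_def _ _
  have hbC : algebraMap D L y * b ∈ C := ⟨b, hb, rfl⟩
  obtain ⟨z, hz⟩ := Submodule.mem_span_singleton.1 (hCT hbC)
  rw [Algebra.smul_def, mul_one] at hz
  have hz0 : z ≠ 0 := by
    rintro rfl
    rw [map_zero] at hz
    exact mul_ne_zero hy0 hb0 hz.symm
  have hzC : Submodule.span D {algebraMap D L z} ≤ C := by
    rw [Submodule.span_singleton_le_iff_mem, hz]
    exact hbC
  have hfin : relLength C T ≠ ⊤ := by
    refine ne_top_of_le_ne_top (relLength_span_ne_top (L := L) hz0) ?_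
    rw [relLength_add hzC hCT]
    exact le_add_self
  set e := mulEquiv D hx
  have hxT : T.map (e : L →ₗ[D] L) = Submodule.span D {algebraMap D L x} := by
    rw [Submodule.map_span, Set.image_singleton]
    congr 2
    exact mul_one _
  have hle : ∀ N : Submodule D L, N.map (e : L →ₗ[D] L) ≤ N := by
    rintro N _ ⟨n, hn, rfl⟩
    have : algebraMap D L x * n = x • n := (Algebra.smul_def _ _).symm
    change algebraMap D L x * n ∈ N
    rw [this]
    exact N.smul_mem _ hn
  -- The chains `xC ≤ C ≤ T` and `xC ≤ xT ≤ T` have the same total length, and `T / C` and `xT / xC`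
  -- have the same finite length, which cancels.
  have h1 := relLength_add (hle C) hCT
  rw [relLength_add (Submodule.map_mono hCT) (hle T), relLength_map, add_comm] at h1
  have h2 : relLength (C.map (e : L →ₗ[D] L)) C = relLength (B.map (e : L →ₗ[D] L)) B := by
    rw [← relLength_map (mulEquiv D hy0) (B.map (e : L →ₗ[D] L)) B]
    congr 1
    rw [← Submodule.map_comp, ← Submodule.map_comp]
    congr 1
    ext a
    change algebraMap D L x * (algebraMap D L y * a) = algebraMap D L y * (algebraMap D L x * a)
    ring
  rw [← h2, ← hxT]
  exact ((ENat.add_left_injective_of_ne_top hfin) h1.symm).le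

end Complete

/-! ### Finiteness and locality of the integral closure -/

section Complete

open IsLocalRing

/-- A finitely generated submodule of greatest length cannot be enlarged by adjoining an element. -/
theorem finite_of_length_le {R M : Type*} [CommRing R] [AddCommGroup M] [Module R M] {l : ℕ∞}
    (hl : l ≠ ⊤) (h : ∀ S : Submodule R M, S.FG → Module.length R S ≤ l) :
    Module.Finite R M := by
  lift l to ℕ using hl
  obtain ⟨_, ⟨S, hS, rfl⟩, hmax⟩ : ∃ n ∈ (fun S : Submodule R M => Module.length R S) ''
      {S | S.FG}, ∀ k ∈ (fun S : Submodule R M => Module.length R S) '' {S | S.FG}, k ≤ n := by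
    have hfin : ((fun S : Submodule R M => Module.length R S) '' {S | S.FG}).Finite := by
      refine (Set.Finite.image (fun k : ℕ => (k : ℕ∞)) (Set.finite_Iic l)).subset ?_
      rintro _ ⟨S, hS, rfl⟩
      have h1 := h S hS
      obtain ⟨k, hk⟩ := ENat.ne_top_iff_exists.1 (ne_top_of_le_ne_top (ENat.natCast_ne_top l) h1)
      simp only at hk ⊢
      rw [← hk] at h1
      exact ⟨k, Nat.cast_le.1 h1, hk⟩
    exact Set.exists_max_image _ id hfin ⟨_, ⊥, Submodule.fg_bot, rfl⟩
  suffices S = ⊤ from ⟨this ▸ hS⟩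
  rw [eq_top_iff]
  intro q _
  by_contra hq
  have hlt : S < S ⊔ Submodule.span R {q} := by
    refine lt_of_le_of_ne le_sup_left fun h => hq ?_
    rw [h]
    exact Submodule.mem_sup_right (Submodule.mem_span_singleton_self q)
  have h1 := hmax _ ⟨_, hS.sup (Submodule.fg_span_singleton q), rfl⟩
  have h2 := h S hS
  simp only [Module.length_submodule] at h1 h2
  exact h1.not_gt (Order.height_strictMono hlt (h2.trans_lt (ENat.natCast_lt_top l)))

variable {D : Type*} [CommRing D] [IsLocalRing D]

/-- Every prime containing `u` is the maximal ideal, so the radical of `(u)` contains it. -/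
theorem exists_pow_maximalIdeal_le [IsNoetherianRing D] [Ring.DimensionLEOne D] {u : D} (hu : u ≠ 0) :
    ∃ n, maximalIdeal D ^ n ≤ Ideal.span {u} := by
  obtain ⟨n, hn⟩ := Ideal.exists_radical_pow_le_of_fg (Ideal.span {u})
    (IsNoetherian.noetherian _)
  refine ⟨n, (Ideal.pow_right_mono ?_ n).trans hn⟩
  rw [Ideal.radical_eq_sInf]
  refine le_sInf fun P ⟨hP, hP'⟩ => ?_
  have hne : P ≠ ⊥ := by
    rintro rfl
    exact hu (by simpa using hP (Ideal.mem_span_singleton_self u))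
  exact (IsLocalRing.eq_maximalIdeal (Ring.DimensionLEOne.maximalOfPrime hne hP')).ge

theorem map_maximalIdeal_ne_top (A : Type*) [CommRing A] [Algebra D A] [Algebra.IsIntegral D A]
    [FaithfulSMul D A] : (maximalIdeal D).map (algebraMap D A) ≠ ⊤ := by
  obtain ⟨Q, hQ, h⟩ := Ideal.exists_ideal_over_maximal_of_isIntegral (S := A) (maximalIdeal D)
    (by rw [(RingHom.injective_iff_ker_eq_bot _).1 (FaithfulSMul.algebraMap_injective D A)]
        exact bot_le)
  intro htop
  refine hQ.ne_top (top_le_iff.1 (htop ▸ Ideal.map_le_iff_le_comap.2 h.ge))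

variable {L : Type*} [Field L] [Algebra D L] [IsFractionRing D L]

theorem exists_algebraMap_eq_mul {a : integralClosure D L} (ha : a ≠ 0) :
    ∃ (u : D) (b : integralClosure D L), u ≠ 0 ∧ algebraMap D _ u = a * b := by
  obtain ⟨u, w, hw, h⟩ := IsFractionRing.div_surjective (A := D) (a : L)
  have hw0 : algebraMap D L w ≠ 0 := IsFractionRing.to_map_ne_zero_of_mem_nonZeroDivisors hw
  refine ⟨u, algebraMap D _ w, ?_, Subtype.ext ?_⟩
  · rintro rfl
    rw [map_zero, zero_div] at h
    exact ha (Subtype.ext h.symm)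
  · change algebraMap D L u = a * algebraMap D L w
    rw [← h, div_mul_cancel₀ _ hw0]

variable [IsDomain D] [IsNoetherianRing D] [Ring.DimensionLEOne D]

/-- The Krull–Akizuki bound: for `x` in the maximal ideal, every finitely generated submodule of
this quotient is an image of some `B / xB` with `B` finitely generated in `L`, so its length is at
most that of `D / xD`. -/
theorem finite_quotient_integralClosure (hD : maximalIdeal D ≠ ⊥) :
    Module.Finite D (integralClosure D L ⧸
      (maximalIdeal D • ⊤ : Submodule D (integralClosure D L))) := by
  obtain ⟨x, hxm, hx0⟩ := Submodule.exists_mem_ne_zero_of_ne_bot hD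
  have hx : algebraMap D L x ≠ 0 := by
    rwa [Ne, FaithfulSMul.algebraMap_eq_zero_iff]
  refine finite_of_length_le (relLength_span_ne_top (L := L) hx0) fun S hS => ?_
  obtain ⟨t, rfl⟩ := hS
  choose f hf using Submodule.mkQ_surjective
    (maximalIdeal D • ⊤ : Submodule D (integralClosure D L))
  classical
  set B₀ := Submodule.span D ((t.image f : Finset (integralClosure D L)) :
    Set (integralClosure D L)) with hB₀
  have hmap : B₀.map (Submodule.mkQ (maximalIdeal D • ⊤ : Submodule D (integralClosure D L))) =
      Submodule.span D (t : Set (integralClosure D L ⧸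
        (maximalIdeal D • ⊤ : Submodule D (integralClosure D L)))) := by
    rw [Submodule.map_span, Finset.coe_image, Set.image_image]
    simp only [hf, Set.image_id']
  let v : integralClosure D L →ₗ[D] L := (integralClosure D L).val.toLinearMap
  have hv : Function.Injective v := Subtype.val_injective
  refine le_trans ?_ (relLength_mul_le hx (B := B₀.map v) (Submodule.FG.map _ ⟨_, rfl⟩))
  let ψ := (Submodule.equivMapOfInjective v hv B₀).symm
  let φ : B₀ →ₗ[D] Submodule.span D (t : Set (integralClosure D L ⧸
      (maximalIdeal D • ⊤ : Submodule D (integralClosure D L)))) :=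
    (Submodule.mkQ _).restrict fun b hb => hmap ▸ Submodule.mem_map_of_mem hb
  have hφ : Function.Surjective φ := by
    rintro ⟨q, hq⟩
    rw [← hmap] at hq
    obtain ⟨b, hb, rfl⟩ := hq
    exact ⟨⟨b, hb⟩, rfl⟩
  refine Module.length_le_of_surjective (Submodule.liftQ _ (φ ∘ₗ ψ.toLinearMap) ?_) ?_
  · rintro ⟨b, hb⟩ ⟨c, hc, hbc⟩
    rw [LinearMap.mem_ker]
    have h1 : (⟨b, hb⟩ : B₀.map v) = x • ⟨c, hc⟩ := by
      refine Subtype.ext (hbc.symm.trans ?_)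
      exact (Algebra.smul_def x c).symm
    rw [h1, map_smul]
    refine Subtype.ext ?_
    change x • Submodule.mkQ _ _ = 0
    rw [← map_smul]
    exact (Submodule.Quotient.mk_eq_zero _).2 (Submodule.smul_mem_smul hxm trivial)
  · rw [← LinearMap.range_eq_top, Submodule.range_liftQ, LinearMap.range_eq_top]
    exact hφ.comp ψ.surjective

/-- A nonzero `a` in all powers has a nonzero multiple `u` in `D`. Since `(u)` contains a power of
the maximal ideal, `u` lies in the extended maximal ideal times `u`; cancelling `u` contradicts
lying over. -/
theorem isHausdorff_integralClosure :
    IsHausdorff (maximalIdeal D) (integralClosure D L) := by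
  refine ⟨fun a ha => ?_⟩
  by_contra hne
  obtain ⟨u, b, hu, hub⟩ := exists_algebraMap_eq_mul hne
  obtain ⟨n, hn⟩ := exists_pow_maximalIdeal_le hu
  have h1 := ha (n + 1)
  rw [SModEq.zero, Ideal.smul_top_eq_map, Submodule.restrictScalars_mem, Ideal.map_pow] at h1
  have h2 : algebraMap D (integralClosure D L) u ∈
      (maximalIdeal D).map (algebraMap D (integralClosure D L)) *
        Ideal.span {algebraMap D (integralClosure D L) u} := by
    rw [pow_succ'] at h1
    refine Ideal.mul_mono_right ?_ (hub ▸ Ideal.mul_mem_right b _ h1)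
    rw [← Ideal.map_pow, ← Set.image_singleton, ← Ideal.map_span]
    exact Ideal.map_mono hn
  obtain ⟨v, hv, h3⟩ := Ideal.mem_mul_span_singleton.1 h2
  have hu' : algebraMap D (integralClosure D L) u ≠ 0 := by
    rwa [Ne, FaithfulSMul.algebraMap_eq_zero_iff]
  have h4 : v = 1 := mul_right_cancel₀ hu' (h3.trans (one_mul _).symm)
  exact map_maximalIdeal_ne_top (D := D) (integralClosure D L)
    ((Ideal.eq_top_iff_one _).2 (h4 ▸ hv))

variable [IsAdicComplete (maximalIdeal D) D]

/-- The integral closure of a complete one-dimensional Noetherian local domain is finite. -/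
theorem finite_integralClosure (hD : maximalIdeal D ≠ ⊥) :
    Module.Finite D (integralClosure D L) := by
  have := finite_quotient_integralClosure (D := D) (L := L) hD
  have := isHausdorff_integralClosure (D := D) (L := L)
  obtain ⟨n, f, hf⟩ := Module.Finite.exists_fin' D (integralClosure D L ⧸
      (maximalIdeal D • ⊤ : Submodule D (integralClosure D L)))
  -- Generators modulo the maximal ideal are lifted to a map from `D^n`. As the source is complete
  -- and the target separated, surjectivity modulo the maximal ideal gives surjectivity.
  obtain ⟨g, hg⟩ := Module.projective_lifting_property (Submodule.mkQ _) f
    (Submodule.mkQ_surjective (maximalIdeal D • ⊤ : Submodule D (integralClosure D L)))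
  have := isPrecomplete_of_finite (M := Fin n → D) (maximalIdeal D)
  exact Module.Finite.of_surjective g
    (surjective_of_mkQ_comp_surjective (I := maximalIdeal D) (by rw [hg]; exact hf))

theorem isDedekindDomain_integralClosure (hD : maximalIdeal D ≠ ⊥) :
    IsDedekindDomain (integralClosure D L) := by
  have := finite_integralClosure (D := D) (L := L) hD
  have hnoeth : IsNoetherianRing (integralClosure D L) := 
    IsNoetherianRing.of_finite D _
  have : IsFractionRing (integralClosure D L) L :=
    integralClosure.isFractionRing_of_finite_extension (A := D) L L
  have : IsIntegrallyClosed (integralClosure D L) :=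
    integralClosure.isIntegrallyClosedOfFiniteExtension (R := D) L
  exact { toIsNoetherian := hnoeth
          maximalOfPrime := Ring.DimensionLEOne.maximalOfPrime }

/-- Two maximal ideals would split `𝔪` into comaximal factors and give a nontrivial idempotent
modulo `𝔪`. It lifts to a root of `X ^ 2 - X`, but a domain has only the roots 0 and 1. -/
theorem isLocalRing_of_henselianRing {A : Type*} [CommRing A] [IsDedekindDomain A] (𝔪 : Ideal A)
    [h4 : HenselianRing A 𝔪] (h𝔪0 : 𝔪 ≠ ⊥) : IsLocalRing A := by
  have hover : ∀ M : Ideal A, M.IsMaximal → 𝔪 ≤ M := fun M hM =>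
    h4.jac.trans (sInf_le ⟨bot_le, hM⟩)
  refine IsLocalRing.of_unique_max_ideal ?_
  obtain ⟨M, hM⟩ := Ideal.exists_maximal A
  refine ⟨M, hM, fun M' hM' => ?_⟩
  by_contra hne
  have hM0 : M ≠ ⊥ := fun h => h𝔪0 (le_bot_iff.1 (h ▸ hover M hM))
  have hfm : FiniteMultiplicity M 𝔪 :=
    FiniteMultiplicity.of_prime_left (Ideal.prime_of_isPrime hM0 hM.isPrime) h𝔪0
  obtain ⟨Q, hQ, hQ'⟩ := hfm.exists_eq_pow_mul_and_not_dvd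
  set k := multiplicity M 𝔪
  have hk : k ≠ 0 := by
    intro hk
    rw [hk, pow_zero, one_mul] at hQ
    exact hQ' (hQ ▸ Ideal.dvd_iff_le.2 (hover M hM))
  have hQM' : Q ≤ M' := by
    have := hover M' hM'
    rw [hQ] at this
    refine (hM'.isPrime.mul_le.1 this).resolve_left fun h => hne ?_
    exact (hM.eq_of_le hM'.ne_top (hM'.isPrime.le_of_pow_le h)).symm
  have hsup : M ⊔ Q = ⊤ := by
    by_contra hc
    have := hM.eq_of_le hc le_sup_left
    exact hQ' (Ideal.dvd_iff_le.2 (this ▸ le_sup_right))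
  have hcop : M ^ k ⊔ Q = ⊤ :=
    Ideal.isCoprime_iff_sup_eq.1 (IsCoprime.pow_left (Ideal.isCoprime_iff_sup_eq.2 hsup))
  obtain ⟨u, hu, v, hv, huv⟩ := Submodule.mem_sup.1 ((Ideal.eq_top_iff_one _).1 hcop)
  have huv𝔪 : u * v ∈ 𝔪 := hQ ▸ Ideal.mul_mem_mul hu hv
  have hu2 : u ^ 2 - u ∈ 𝔪 := by
    have : u ^ 2 - u = -(u * v) := by linear_combination u * huv
    rw [this]
    exact 𝔪.neg_mem huv𝔪
  -- The derivative `2 * u - 1` is a unit modulo `𝔪` because its square is 1 there.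
  obtain ⟨a, ha, hau⟩ := h4.is_henselian (Polynomial.X ^ 2 - Polynomial.X)
    (by monicity!) u (by simpa using hu2) (by
      refine IsUnit.of_mul_eq_one (Ideal.Quotient.mk 𝔪 (2 * u - 1)) ?_
      rw [← map_mul, ← map_one (Ideal.Quotient.mk 𝔪), Ideal.Quotient.eq]
      have : (2 * u - 1) * (2 * u - 1) - 1 = 4 * (u ^ 2 - u) := by ring
      simp only [Polynomial.derivative_sub, Polynomial.derivative_X_pow, Polynomial.derivative_X,
        Polynomial.eval_sub, Polynomial.eval_mul, Polynomial.eval_X,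
        Polynomial.eval_one, Polynomial.eval_C, Nat.cast_ofNat, Nat.add_one_sub_one, pow_one]
      rw [this]
      exact 𝔪.mul_mem_left _ hu2)
  have ha' : a = 0 ∨ a = 1 := by
    have : a * (a - 1) = 0 := by
      have := ha.eq_zero
      simp at this
      linear_combination this
    rcases mul_eq_zero.1 this with h | h
    · exact Or.inl h
    · exact Or.inr (sub_eq_zero.1 h)
  rcases ha' with rfl | rfl
  · have hu' : u ∈ M' := hover M' hM' (by simpa using hau)
    exact hM'.ne_top ((Ideal.eq_top_iff_one _).2 (huv ▸ M'.add_mem hu' (hQM' hv)))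
  · have hv' : v ∈ M := hover M hM (by rwa [← huv, add_sub_cancel_left] at hau)
    exact hM.ne_top ((Ideal.eq_top_iff_one _).2
      (huv ▸ M.add_mem (Ideal.pow_le_self hk hu) hv'))

/-- Finite over the complete ring `D`, the closure is complete, hence henselian, along the extended
maximal ideal. -/
theorem isLocalRing_integralClosure (hD : maximalIdeal D ≠ ⊥) :
    IsLocalRing (integralClosure D L) := by
  have := finite_integralClosure (D := D) (L := L) hD
  have := isDedekindDomain_integralClosure (D := D) (L := L) hD
  have h1 := isHausdorff_integralClosure (D := D) (L := L)
  have h2 := isPrecomplete_of_finite (M := integralClosure D L) (maximalIdeal D)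
  have h3 : IsAdicComplete ((maximalIdeal D).map (algebraMap D (integralClosure D L)))
      (integralClosure D L) :=
    (IsAdicComplete.map_algebraMap_iff _ _).2 { h1, h2 with }
  refine isLocalRing_of_henselianRing
    ((maximalIdeal D).map (algebraMap D (integralClosure D L))) ?_
  rw [Ne, Ideal.map_eq_bot_iff_of_injective (FaithfulSMul.algebraMap_injective D _)]
  exact hD

/-- The integral closure of a complete one-dimensional Noetherian local domain is a discrete
valuation ring. -/
theorem isDiscreteValuationRing_integralClosure (hD : maximalIdeal D ≠ ⊥) :
    IsDiscreteValuationRing (integralClosure D L) := by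
  have hded := isDedekindDomain_integralClosure (D := D) (L := L) hD
  have := isLocalRing_integralClosure (D := D) (L := L) hD
  have hf : ¬ IsField (integralClosure D L) := fun h =>
    IsLocalRing.isField_iff_maximalIdeal_eq.not.2 hD
      (isField_of_isIntegral_of_isField (FaithfulSMul.algebraMap_injective D _) h)
  exact ((IsDiscreteValuationRing.TFAE _ hf).out 0 2).2 hded

end Complete

/-! ### The filtration of the fraction field of a discrete valuation ring -/

section DVR

variable {A : Type*} [CommRing A] (K : Type*) [Field K] [Algebra A K]

/-- The fractional ideal generated by the `n`-th power of `ϖ`. -/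
def zpowIdeal (ϖ : A) (n : ℤ) : Submodule A K :=
  Submodule.span A {algebraMap A K ϖ ^ n}

variable {K}

theorem mem_zpowIdeal {ϖ : A} {n : ℤ} {x : K} :
    x ∈ zpowIdeal K ϖ n ↔ ∃ a : A, algebraMap A K a * algebraMap A K ϖ ^ n = x := by
  rw [zpowIdeal, Submodule.mem_span_singleton]
  simp only [Algebra.smul_def]

variable [IsFractionRing A K] {ϖ : A}

theorem algebraMap_irreducible_ne_zero (hϖ : Irreducible ϖ) : algebraMap A K ϖ ≠ 0 := by
  rw [Ne, FaithfulSMul.algebraMap_eq_zero_iff]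
  exact hϖ.ne_zero

theorem zpowIdeal_antitone (hϖ : Irreducible ϖ) : Antitone (zpowIdeal K ϖ) := by
  intro m n hmn x hx
  obtain ⟨a, rfl⟩ := mem_zpowIdeal.1 hx
  refine mem_zpowIdeal.2 ⟨a * ϖ ^ (n - m).toNat, ?_⟩
  rw [map_mul, map_pow, mul_assoc, ← zpow_natCast, ← zpow_add₀ (algebraMap_irreducible_ne_zero hϖ),
    Int.toNat_of_nonneg (by omega), sub_add_cancel]

theorem mul_zpow_mem_succ_iff (hϖ : Irreducible ϖ) {a : A} {n : ℤ} :
    algebraMap A K a * algebraMap A K ϖ ^ n ∈ zpowIdeal K ϖ (n + 1) ↔ ϖ ∣ a := by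
  have h0 := algebraMap_irreducible_ne_zero (K := K) hϖ
  rw [mem_zpowIdeal]
  constructor
  · rintro ⟨b, hb⟩
    rw [zpow_add_one₀ h0, mul_comm (_ ^ n), ← mul_assoc] at hb
    have := mul_right_cancel₀ (zpow_ne_zero n h0) hb
    rw [← map_mul] at this
    exact ⟨b, by rw [mul_comm]; exact (FaithfulSMul.algebraMap_injective A K this).symm⟩
  · rintro ⟨b, rfl⟩
    exact ⟨b, by rw [zpow_add_one₀ h0, map_mul]; ring⟩

theorem mul_mem_zpowIdeal_iff (hϖ : Irreducible ϖ) (u : Aˣ) (m n : ℤ) (x : K) :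
    algebraMap A K u * algebraMap A K ϖ ^ m * x ∈ zpowIdeal K ϖ (n + m) ↔
      x ∈ zpowIdeal K ϖ n := by
  have h0 := algebraMap_irreducible_ne_zero (K := K) hϖ
  have hu : algebraMap A K (u⁻¹ : Aˣ) * algebraMap A K u = 1 := by
    rw [← map_mul, Units.inv_mul, map_one]
  rw [mem_zpowIdeal, mem_zpowIdeal]
  constructor
  · rintro ⟨a, ha⟩
    refine ⟨(u⁻¹ : Aˣ) * a, mul_right_cancel₀ (zpow_ne_zero m h0) ?_⟩
    rw [map_mul, mul_assoc, ← zpow_add₀ h0, mul_assoc, ha]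
    linear_combination (algebraMap A K ϖ ^ m * x) * hu
  · rintro ⟨a, rfl⟩
    exact ⟨u * a, by rw [zpow_add₀ h0, map_mul]; ring⟩

variable [IsDomain A] [IsDiscreteValuationRing A]

theorem dvd_iff_not_isUnit (hϖ : Irreducible ϖ) {a : A} : ϖ ∣ a ↔ ¬ IsUnit a := by
  rw [← Ideal.mem_span_singleton, ← (IsDiscreteValuationRing.irreducible_iff_uniformizer ϖ).1 hϖ]
  exact IsLocalRing.mem_maximalIdeal a

theorem nonunit_mul_mem_succ (hϖ : Irreducible ϖ) {c : A} (hc : ¬ IsUnit c) {n : ℤ} {x : K}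
    (hx : x ∈ zpowIdeal K ϖ n) : algebraMap A K c * x ∈ zpowIdeal K ϖ (n + 1) := by
  obtain ⟨a, rfl⟩ := mem_zpowIdeal.1 hx
  rw [← mul_assoc, ← map_mul, mul_zpow_mem_succ_iff hϖ]
  exact ((dvd_iff_not_isUnit hϖ).2 hc).mul_right _

/-- The witness is the quotient of `x` by `y`, which lies in `A`; only its residue class matters. -/
theorem exists_sub_mul_mem_succ (hϖ : Irreducible ϖ) {x y : K} {n : ℤ}
    (hx : x ∈ zpowIdeal K ϖ n) (hy : y ∈ zpowIdeal K ϖ n) (hy' : y ∉ zpowIdeal K ϖ (n + 1)) :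
    ∃ a : A, ∀ c : A, ¬ IsUnit (a - c) → x - algebraMap A K c * y ∈ zpowIdeal K ϖ (n + 1) := by
  obtain ⟨a, rfl⟩ := mem_zpowIdeal.1 hx
  obtain ⟨b, rfl⟩ := mem_zpowIdeal.1 hy
  rw [mul_zpow_mem_succ_iff hϖ, dvd_iff_not_isUnit hϖ, not_not] at hy'
  obtain ⟨b, rfl⟩ := hy'
  refine ⟨a * (b⁻¹ : Aˣ), fun c hc => ?_⟩
  have h1 := nonunit_mul_mem_succ (K := K) hϖ hc hy
  have h2 : algebraMap A K (b⁻¹ : Aˣ) * algebraMap A K b = 1 := by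
    rw [← map_mul, Units.inv_mul, map_one]
  convert h1 using 1
  rw [map_sub, map_mul]
  linear_combination (-(algebraMap A K a * algebraMap A K ϖ ^ n)) * h2

theorem exists_unit_mul_zpow (hϖ : Irreducible ϖ) {x : K} (hx : x ≠ 0) :
    ∃ (u : Aˣ) (n : ℤ), x = algebraMap A K u * algebraMap A K ϖ ^ n := by
  have h0 := algebraMap_irreducible_ne_zero (K := K) hϖ
  obtain ⟨a, b, hb, rfl⟩ := IsFractionRing.div_surjective (A := A) x
  have hb0 : b ≠ 0 := nonZeroDivisors.ne_zero hb
  have ha0 : a ≠ 0 := by rintro rfl; simp at hx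
  obtain ⟨k, u, rfl⟩ := IsDiscreteValuationRing.eq_unit_mul_pow_irreducible ha0 hϖ
  obtain ⟨l, v, rfl⟩ := IsDiscreteValuationRing.eq_unit_mul_pow_irreducible hb0 hϖ
  refine ⟨u * v⁻¹, k - l, ?_⟩
  have hv : algebraMap A K v ≠ 0 := by
    rw [Ne, FaithfulSMul.algebraMap_eq_zero_iff]; exact v.ne_zero
  have hvv : algebraMap A K v * algebraMap A K (v⁻¹ : Aˣ) = 1 := by
    rw [← map_mul, Units.mul_inv, map_one]
  rw [zpow_sub₀ h0, zpow_natCast, zpow_natCast, Units.val_mul, map_mul, map_mul, map_mul, map_pow,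
    map_pow]
  field_simp
  exact hvv.symm

/-- Two uniformizers differ by a unit, so the value may be read off from any fixed one. -/
theorem hasValue_iff {A K : Type u} [CommRing A] [Field K] [Algebra A K] [IsDomain A]
    [IsFractionRing A K] [IsDiscreteValuationRing A] {ϖ : A} (hϖ : Irreducible ϖ) {x : K} {n : ℤ} :
    HasValue A x n ↔ x ∈ zpowIdeal K ϖ n ∧ x ∉ zpowIdeal K ϖ (n + 1) := by
  constructor
  · rintro ⟨ϖ', u, hϖ', hu, rfl⟩
    obtain ⟨v, rfl⟩ := IsDiscreteValuationRing.associated_of_irreducible A hϖ hϖ'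
    have hv : algebraMap A K v ^ n = algebraMap A K ((v ^ n : Aˣ) : A) := by
      have := congrArg Units.val (map_zpow (Units.map (algebraMap A K : A →* K)) v n)
      rw [Units.val_zpow_eq_zpow_val] at this
      exact this.symm
    have : algebraMap A K u * algebraMap A K (ϖ * v) ^ n =
        algebraMap A K (u * (v ^ n : Aˣ)) * algebraMap A K ϖ ^ n := by
      rw [map_mul, mul_zpow, hv, map_mul]
      ring
    rw [this, mul_zpow_mem_succ_iff hϖ, dvd_iff_not_isUnit hϖ, not_not]
    exact ⟨mem_zpowIdeal.2 ⟨_, rfl⟩, hu.mul (Units.isUnit _)⟩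
  · rintro ⟨h1, h2⟩
    obtain ⟨a, rfl⟩ := mem_zpowIdeal.1 h1
    rw [mul_zpow_mem_succ_iff hϖ, dvd_iff_not_isUnit hϖ, not_not] at h2
    exact ⟨ϖ, a, hϖ, h2, rfl⟩

end DVR

/-! ### The total ring of fractions and its branches -/

section Reduced

variable {R : Type u} [CommRing R]

theorem branchProj_algebraMap (p : minimalPrimes R) (r : R) :
    branchProj p (algebraMap R (FractionRing R) r) =
      algebraMap (R ⧸ p.1) (FractionRing (R ⧸ p.1)) (Ideal.Quotient.mk p.1 r) :=
  IsLocalization.map_eq _ _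

theorem branchProj_smul (p : minimalPrimes R) (r : R) (h : FractionRing R) :
    branchProj p (r • h) =
      algebraMap (R ⧸ p.1) (FractionRing (R ⧸ p.1)) (Ideal.Quotient.mk p.1 r) *
        branchProj p h := by
  rw [Algebra.smul_def, map_mul, branchProj_algebraMap]

theorem branchProj_algebraMap_eq_zero {p : minimalPrimes R} {r : R} :
    branchProj p (algebraMap R (FractionRing R) r) = 0 ↔ r ∈ p.1 := by
  rw [branchProj_algebraMap, FaithfulSMul.algebraMap_eq_zero_iff, Ideal.Quotient.eq_zero_iff_mem]

theorem notMem_of_mem_nonZeroDivisors {p : minimalPrimes R} {r : R} (hr : r ∈ R⁰) : r ∉ p.1 :=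
  fun h => notMem_nonZeroDivisors_of_mem_mem_minimalPrimes h p.2 hr

theorem eq_zero_of_forall_mem [IsReduced R] {r : R} (h : ∀ p : minimalPrimes R, r ∈ p.1) :
    r = 0 := by
  have : r ∈ nilradical R := by
    rw [nilradical, ← Ideal.sInf_minimalPrimes]
    exact Submodule.mem_sInf.2 fun P hP => h ⟨P, hP⟩
  rwa [nilradical_eq_zero] at this

theorem mem_nonZeroDivisors_of_forall_notMem [IsReduced R] {r : R}
    (h : ∀ p : minimalPrimes R, r ∉ p.1) : r ∈ R⁰ := by
  rw [mem_nonZeroDivisors_iff_right]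
  intro x hx
  refine eq_zero_of_forall_mem fun p => ?_
  exact (p.2.1.1.mem_or_mem (hx ▸ p.1.zero_mem : x * r ∈ p.1)).resolve_right (h p)

theorem exists_mul_eq_algebraMap (h : FractionRing R) : ∃ a s : R, s ∈ R⁰ ∧
    h * algebraMap R (FractionRing R) s = algebraMap R (FractionRing R) a := by
  obtain ⟨⟨a, s⟩, hs⟩ := IsLocalization.surj R⁰ h
  exact ⟨a, s, s.2, hs⟩

theorem branchProj_eq_zero_iff {p : minimalPrimes R} {h : FractionRing R} {a s : R} (hs : s ∈ R⁰)
    (has : h * algebraMap R (FractionRing R) s = algebraMap R (FractionRing R) a) :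
    branchProj p h = 0 ↔ a ∈ p.1 := by
  rw [← branchProj_algebraMap_eq_zero, ← has, map_mul, mul_eq_zero, branchProj_algebraMap_eq_zero]
  exact ⟨Or.inl, fun h => h.resolve_right (notMem_of_mem_nonZeroDivisors hs)⟩

theorem eq_zero_of_branchProj [IsReduced R] {h : FractionRing R}
    (hh : ∀ p, branchProj p h = 0) : h = 0 := by
  obtain ⟨a, s, hs, has⟩ := exists_mul_eq_algebraMap h
  have ha : a = 0 := eq_zero_of_forall_mem fun p => (branchProj_eq_zero_iff hs has).1 (hh p)
  rw [ha, map_zero] at has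
  exact (IsLocalization.map_units (FractionRing R) (⟨s, hs⟩ : R⁰)).mul_left_eq_zero.1 has

theorem eq_of_branchProj [IsReduced R] {h h' : FractionRing R}
    (hh : ∀ p, branchProj p h = branchProj p h') : h = h' :=
  sub_eq_zero.1 (eq_zero_of_branchProj fun p => by rw [map_sub, hh, sub_self])

/-- Distinct minimal primes are incomparable; multiply elements taken from each `q` outside `p`. -/
theorem exists_mem_of_ne [Finite (minimalPrimes R)] (p : minimalPrimes R) :
    ∃ s : R, s ∉ p.1 ∧ ∀ q : minimalPrimes R, q ≠ p → s ∈ q.1 := by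
  classical
  cases nonempty_fintype (minimalPrimes R)
  have h1 : ∀ q : minimalPrimes R, ∃ s : R, s ∉ p.1 ∧ (q ≠ p → s ∈ q.1) := by
    intro q
    by_cases hq : q = p
    · exact ⟨1, p.2.1.1.one_notMem, fun h => absurd hq h⟩
    · have : ¬ q.1 ≤ p.1 := fun h => hq (Subtype.ext (h.antisymm (p.2.2 q.2.1 h)))
      obtain ⟨s, hs, hs'⟩ := SetLike.not_le_iff_exists.1 this
      exact ⟨s, hs', fun _ => hs⟩
  choose s hs hs' using h1
  refine ⟨∏ q, s q, fun h => ?_, fun q hq => ?_⟩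
  · obtain ⟨q, -, hq⟩ := p.2.1.1.prod_mem_iff.1 h
    exact hs q hq
  · exact Ideal.mem_of_dvd _ (Finset.dvd_prod_of_mem s (Finset.mem_univ q)) (hs' q hq)

/-- The `s p` stand in for idempotents: modulo `p` only the summand of index `p` survives, so such
sums prescribe all branches at once up to the factors `s p`. -/
theorem exists_combination [IsReduced R] [Finite (minimalPrimes R)] :
    ∃ s : minimalPrimes R → R, (∀ p, s p ∉ p.1) ∧ (∀ p q, q ≠ p → s p ∈ q.1) ∧
      ∀ [Fintype (minimalPrimes R)] (b : minimalPrimes R → R), (∀ p, b p ∉ p.1) →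
        (∑ p, s p * b p) ∈ R⁰ := by
  classical
  choose s hs hs' using exists_mem_of_ne (R := R)
  refine ⟨s, hs, hs', fun b hb => mem_nonZeroDivisors_of_forall_notMem fun p hp => ?_⟩
  rw [← Finset.add_sum_erase _ _ (Finset.mem_univ p)] at hp
  have h1 : ∑ q ∈ Finset.univ.erase p, s q * b q ∈ p.1 := p.1.sum_mem fun q hq =>
    p.1.mul_mem_right _ (hs' q p (Finset.ne_of_mem_erase hq).symm)
  have h2 := (Ideal.add_mem_iff_left _ h1).1 hp
  exact (p.2.1.1.mem_or_mem h2).elim (hs p) (hb p)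

/-- The total ring of fractions is the product of the fraction fields of the branches. -/
theorem exists_branchProj_eq [IsReduced R] [Finite (minimalPrimes R)]
    (x : ∀ p : minimalPrimes R, FractionRing (R ⧸ p.1)) :
    ∃ h : FractionRing R, ∀ p, branchProj p h = x p := by
  classical
  cases nonempty_fintype (minimalPrimes R)
  obtain ⟨s, hs, hs', hsb⟩ := exists_combination (R := R)
  have h1 : ∀ p, ∃ a b : R, b ∉ p.1 ∧
      x p * algebraMap (R ⧸ p.1) (FractionRing (R ⧸ p.1)) (Ideal.Quotient.mk p.1 b) =
        algebraMap (R ⧸ p.1) (FractionRing (R ⧸ p.1)) (Ideal.Quotient.mk p.1 a) := by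
    intro p
    obtain ⟨⟨a, ⟨b, hb⟩⟩, hab⟩ := IsLocalization.surj (R ⧸ p.1)⁰ (x p)
    obtain ⟨a, rfl⟩ := Ideal.Quotient.mk_surjective a
    obtain ⟨b, rfl⟩ := Ideal.Quotient.mk_surjective b
    refine ⟨a, b, fun h => nonZeroDivisors.ne_zero hb ?_, hab⟩
    exact Ideal.Quotient.eq_zero_iff_mem.2 h
  choose a b hb hab using h1
  have hsum : ∀ (c : minimalPrimes R → R) p, Ideal.Quotient.mk p.1 (∑ q, s q * c q) =
      Ideal.Quotient.mk p.1 (s p * c p) := by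
    intro c p
    rw [Ideal.Quotient.eq, ← Finset.add_sum_erase _ _ (Finset.mem_univ p), add_sub_cancel_left]
    exact p.1.sum_mem fun q hq =>
      p.1.mul_mem_right _ (hs' q p (Finset.ne_of_mem_erase hq).symm)
  have hmem := hsb b hb
  -- In the quotient of the two sums the factor `s p` cancels on every branch.
  obtain ⟨h, hh⟩ : ∃ h : FractionRing R, h * algebraMap R (FractionRing R) (∑ q, s q * b q) =
      algebraMap R (FractionRing R) (∑ q, s q * a q) :=
    ⟨IsLocalization.mk' _ _ (⟨_, hmem⟩ : R⁰), IsLocalization.mk'_spec _ _ (⟨_, hmem⟩ : R⁰)⟩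
  refine ⟨h, fun p => ?_⟩
  have h2 := congrArg (branchProj p) hh
  have h3 : algebraMap (R ⧸ p.1) (FractionRing (R ⧸ p.1)) (Ideal.Quotient.mk p.1 (s p * b p)) ≠ 0 := by
    rw [← branchProj_algebraMap, Ne, branchProj_algebraMap_eq_zero]
    exact fun h => (p.2.1.1.mem_or_mem h).elim (hs p) (hb p)
  rw [map_mul, branchProj_algebraMap, branchProj_algebraMap, hsum, hsum] at h2
  refine mul_right_cancel₀ h3 (h2.trans ?_)
  rw [map_mul, map_mul, map_mul, map_mul, ← hab p]
  ring

theorem mem_nonZeroDivisors_iff_branchProj [IsReduced R] [Finite (minimalPrimes R)]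
    {h : FractionRing R} : h ∈ (FractionRing R)⁰ ↔ ∀ p, branchProj p h ≠ 0 := by
  classical
  constructor
  · intro hh p hp
    obtain ⟨e, he⟩ := exists_branchProj_eq (R := R) fun q => if q = p then 1 else 0
    have h1 : e * h = 0 := eq_zero_of_branchProj fun q => by
      rw [map_mul, he]
      by_cases hq : q = p
      · subst hq; rw [hp, mul_zero]
      · rw [if_neg hq, zero_mul]
    have h2 := he p
    rw [(mem_nonZeroDivisors_iff_right.1 hh) e h1, map_zero, if_pos rfl] at h2
    exact zero_ne_one h2
  · intro hh
    rw [mem_nonZeroDivisors_iff_right]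
    intro y hy
    refine eq_zero_of_branchProj fun p => ?_
    have := congrArg (branchProj p) hy
    rw [map_mul, map_zero] at this
    exact (mul_eq_zero.1 this).resolve_right (hh p)

theorem algebraMap_mem_nonZeroDivisors_iff {B : Type*} [CommRing B] {b : B} :
    algebraMap B (FractionRing B) b ∈ (FractionRing B)⁰ ↔ b ∈ B⁰ := by
  constructor
  · intro h
    rw [mem_nonZeroDivisors_iff_right] at h ⊢
    intro x hx
    refine IsFractionRing.injective B (FractionRing B) ?_
    rw [map_zero]
    exact h _ (by rw [← map_mul, hx, map_zero])
  · intro h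
    exact (IsLocalization.map_units (FractionRing B) (⟨b, h⟩ : B⁰)).mem_nonZeroDivisors

/-- After clearing denominators this is a statement in `R_J`: an element of `p j` is killed by one
lying in all other minimal primes but not in `p j`. -/
theorem multiProj_mem_nonZeroDivisors_iff [Finite (minimalPrimes R)] {ι : Type*}
    (p : ι → minimalPrimes R) (J : Set ι) {h : FractionRing R} :
    multiProj p J h ∈ (FractionRing (R ⧸ ⨅ j ∈ J, (p j).1))⁰ ↔
      ∀ j ∈ J, branchProj (p j) h ≠ 0 := by
  obtain ⟨a, s, hs, has⟩ := exists_mul_eq_algebraMap h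
  have h1 : ∀ r : R, multiProj p J (algebraMap R (FractionRing R) r) =
      algebraMap _ _ (Ideal.Quotient.mk (⨅ j ∈ J, (p j).1) r) := fun r =>
    IsLocalization.map_eq _ _
  have h2 := congrArg (multiProj p J) has
  rw [map_mul, h1, h1] at h2
  have h3 : multiProj p J h ∈ (FractionRing (R ⧸ ⨅ j ∈ J, (p j).1))⁰ ↔
      Ideal.Quotient.mk (⨅ j ∈ J, (p j).1) a ∈ (R ⧸ ⨅ j ∈ J, (p j).1)⁰ := by
    rw [← algebraMap_mem_nonZeroDivisors_iff (b := Ideal.Quotient.mk (⨅ j ∈ J, (p j).1) a), ← h2, mul_mem_nonZeroDivisors]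
    exact (and_iff_left (algebraMap_mem_nonZeroDivisors_iff.2 (le_comap_inf p J hs))).symm
  rw [h3]
  simp only [ne_eq, branchProj_eq_zero_iff hs has]
  rw [mem_nonZeroDivisors_iff_right]
  constructor
  · intro hm j hj haj
    obtain ⟨y, hy, hy'⟩ := exists_mem_of_ne (p j)
    have h4 := hm (Ideal.Quotient.mk _ y) (by
      rw [← map_mul, Ideal.Quotient.eq_zero_iff_mem]
      simp only [Ideal.mem_iInf]
      intro k hk
      by_cases hkj : p k = p j
      · rw [hkj]; exact Ideal.mul_mem_left _ _ haj
      · exact Ideal.mul_mem_right _ _ (hy' _ hkj))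
    rw [Ideal.Quotient.eq_zero_iff_mem] at h4
    simp only [Ideal.mem_iInf] at h4
    exact hy (h4 j hj)
  · intro hm y hy
    obtain ⟨y, rfl⟩ := Ideal.Quotient.mk_surjective y
    rw [← map_mul, Ideal.Quotient.eq_zero_iff_mem] at hy
    rw [Ideal.Quotient.eq_zero_iff_mem]
    simp only [Ideal.mem_iInf] at hy ⊢
    exact fun j hj => ((p j).2.1.1.mem_or_mem (hy j hj)).resolve_right (hm j hj)

end Reduced

/-! ### Branches of a complete admissible ring -/

namespace IsCompleteAdmissible

variable {R : Type u} [CommRing R] [IsLocalRing R]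

open IsLocalRing

theorem isReduced (hR : IsCompleteAdmissible R) : IsReduced R := by
  have := hR.complete
  have := hR.analyticallyReduced
  exact isReduced_of_injective (algebraMap R (AdicCompletion (maximalIdeal R) R))
    (AdicCompletion.of_injective (maximalIdeal R) R)

theorem finite_minimalPrimes (hR : IsCompleteAdmissible R) : Finite (minimalPrimes R) := by
  have := hR.noetherian
  exact minimalPrimes.finite_of_isNoetherianRing R

theorem ne_maximalIdeal (hR : IsCompleteAdmissible R) (p : minimalPrimes R) :
    p.1 ≠ maximalIdeal R := by
  intro hp
  have h0 : Ring.KrullDimLE 0 R := by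
    rw [Ring.krullDimLE_zero_iff]
    intro P hP
    have h1 : P ≤ p.1 := hp ▸ IsLocalRing.le_maximalIdeal hP.ne_top
    have h2 := h1.antisymm (p.2.2 ⟨hP, bot_le⟩ h1)
    rw [h2, hp]
    infer_instance
  rw [Ring.krullDimLE_iff, hR.dim_eq_one] at h0
  norm_num at h0

theorem dimensionLEOne (hR : IsCompleteAdmissible R) (p : minimalPrimes R) :
    Ring.DimensionLEOne (R ⧸ p.1) := by
  have h1 : Ring.KrullDimLE 1 (R ⧸ p.1) := by
    rw [Ring.krullDimLE_iff]
    refine (ringKrullDim_quotient_le p.1).trans ?_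
    rw [hR.dim_eq_one]
    rfl
  rw [Ring.krullDimLE_one_iff_of_noZeroDivisors] at h1
  exact ⟨fun {P} h h' => h1 P h h'⟩

theorem isLocalRing_quotient (p : minimalPrimes R) : IsLocalRing (R ⧸ p.1) :=
  IsLocalRing.of_surjective' (Ideal.Quotient.mk p.1) Ideal.Quotient.mk_surjective

instance (p : minimalPrimes R) : IsLocalRing (R ⧸ p.1) := isLocalRing_quotient p

theorem map_maximalIdeal (p : minimalPrimes R) :
    (maximalIdeal R).map (Ideal.Quotient.mk p.1) = maximalIdeal (R ⧸ p.1) :=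
  map_maximalIdeal_of_surjective _ Ideal.Quotient.mk_surjective

theorem maximalIdeal_quotient_ne_bot (hR : IsCompleteAdmissible R) (p : minimalPrimes R) :
    maximalIdeal (R ⧸ p.1) ≠ ⊥ := by
  rw [← map_maximalIdeal, Ne, Ideal.map_eq_bot_iff_le_ker, Ideal.mk_ker]
  exact fun h => hR.ne_maximalIdeal p ((IsLocalRing.le_maximalIdeal p.2.1.1.ne_top).antisymm h)

theorem isAdicComplete_quotient (hR : IsCompleteAdmissible R) (p : minimalPrimes R) :
    IsAdicComplete (maximalIdeal (R ⧸ p.1)) (R ⧸ p.1) := by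
  have := hR.noetherian
  have := hR.complete
  have h1 : IsPrecomplete (maximalIdeal R) (R ⧸ p.1) := isPrecomplete_of_finite _
  have h2 : IsHausdorff (maximalIdeal R) (R ⧸ p.1) := inferInstance
  rw [← map_maximalIdeal]
  exact (IsAdicComplete.map_algebraMap_iff (maximalIdeal R) (R ⧸ p.1)).2 { h1, h2 with }

end IsCompleteAdmissible

/-- The integral closure of a branch in its field of fractions. -/
abbrev normalization {R : Type u} [CommRing R] (p : minimalPrimes R) :
    Subalgebra (R ⧸ p.1) (FractionRing (R ⧸ p.1)) :=
  integralClosure (R ⧸ p.1) (FractionRing (R ⧸ p.1))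

instance {R : Type u} [CommRing R] (p : minimalPrimes R) :
    IsFractionRing (normalization p) (FractionRing (R ⧸ p.1)) :=
  integralClosure.isFractionRing_of_finite_extension (A := R ⧸ p.1) (FractionRing (R ⧸ p.1)) _

namespace IsCompleteAdmissible

variable {R : Type u} [CommRing R] [IsLocalRing R]

open IsLocalRing

theorem isDiscreteValuationRing (hR : IsCompleteAdmissible R) (p : minimalPrimes R) :
    IsDiscreteValuationRing (normalization p) := by
  have := hR.noetherian
  have := hR.dimensionLEOne p
  have := hR.isAdicComplete_quotient p
  exact isDiscreteValuationRing_integralClosure (hR.maximalIdeal_quotient_ne_bot p)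

theorem finite_normalization (hR : IsCompleteAdmissible R) (p : minimalPrimes R) :
    Module.Finite (R ⧸ p.1) (normalization p) := by
  have := hR.noetherian
  have := hR.dimensionLEOne p
  have := hR.isAdicComplete_quotient p
  exact finite_integralClosure (hR.maximalIdeal_quotient_ne_bot p)

/-- A common denominator of the normalization of a branch. -/
theorem exists_conductor_branch (hR : IsCompleteAdmissible R) (p : minimalPrimes R) :
    ∃ c : R, c ∉ p.1 ∧ ∀ a : normalization p, ∃ r : R,
      algebraMap (R ⧸ p.1) (FractionRing (R ⧸ p.1)) (Ideal.Quotient.mk p.1 c) * a =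
        algebraMap (R ⧸ p.1) (FractionRing (R ⧸ p.1)) (Ideal.Quotient.mk p.1 r) := by
  classical
  obtain ⟨t, ht⟩ := (hR.finite_normalization p).fg_top
  obtain ⟨⟨c, hc⟩, hct⟩ := IsLocalization.exist_integer_multiples_of_finset (R ⧸ p.1)⁰
    (t.image (fun a : normalization p => (a : FractionRing (R ⧸ p.1))) :)
  obtain ⟨c, rfl⟩ := Ideal.Quotient.mk_surjective c
  refine ⟨c, fun h => nonZeroDivisors.ne_zero hc (Ideal.Quotient.eq_zero_iff_mem.2 h),
    fun a => ?_⟩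
  have ha : a ∈ Submodule.span (R ⧸ p.1) (t : Set (normalization p)) := ht ▸ trivial
  suffices h : ∃ r : R ⧸ p.1,
      algebraMap (R ⧸ p.1) (FractionRing (R ⧸ p.1)) (Ideal.Quotient.mk p.1 c) * a =
        algebraMap (R ⧸ p.1) (FractionRing (R ⧸ p.1)) r by
    obtain ⟨r, hr⟩ := h
    obtain ⟨r, rfl⟩ := Ideal.Quotient.mk_surjective r
    exact ⟨r, hr⟩
  induction ha using Submodule.span_induction with
  | mem x hx =>
    obtain ⟨r, hr⟩ := hct x (Finset.mem_image_of_mem _ hx)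
    exact ⟨r, by rw [hr, Algebra.smul_def]⟩
  | zero => exact ⟨0, by simp⟩
  | add x y _ _ hx hy =>
    obtain ⟨r, hr⟩ := hx
    obtain ⟨s, hs⟩ := hy
    exact ⟨r + s, by rw [map_add, ← hr, ← hs, ← mul_add]; rfl⟩
  | smul d x _ hx =>
    obtain ⟨r, hr⟩ := hx
    refine ⟨d * r, ?_⟩
    rw [map_mul, ← hr, Subalgebra.coe_smul, Algebra.smul_def]
    ring

/-- Residual rationality of the branches. -/
theorem exists_sub_mem_maximalIdeal (hR : IsCompleteAdmissible R) (p : minimalPrimes R)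
    (a : normalization p) : ∃ r : R,
      ¬ IsUnit (a - algebraMap (R ⧸ p.1) (normalization p) (Ideal.Quotient.mk p.1 r)) := by
  classical
  have := hR.isReduced
  have := hR.finite_minimalPrimes
  have := hR.isDiscreteValuationRing p
  have hint : ∀ x : integralClosure R (FractionRing R),
      IsIntegral (R ⧸ p.1) (branchProj p x) := by
    rintro ⟨x, f, hf, hfx⟩
    refine ⟨f.map (Ideal.Quotient.mk p.1), hf.map _, ?_⟩
    have := congrArg (branchProj p) hfx
    rw [map_zero, Polynomial.hom_eval₂] at this
    rw [Polynomial.eval₂_map, ← this]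
    congr 1
    ext r
    exact (branchProj_algebraMap p r).symm
  let φ : integralClosure R (FractionRing R) →+* normalization p :=
    ((branchProj p).comp (algebraMap (integralClosure R (FractionRing R)) (FractionRing R))).codRestrict
      (normalization p) hint
  -- Extend `a` by zero to the other branches. With `g` a monic lift of its equation, `X * g`
  -- vanishes at the result: `g` on the branch `p`, `X` on the others.
  have hφ : Function.Surjective φ := by
    rintro ⟨a, f, hf, hfa⟩
    obtain ⟨h, hh⟩ := exists_branchProj_eq (R := R)
      (Function.update (fun _ => 0) p a)
    obtain ⟨g, hg, -, hgm⟩ := Polynomial.lifts_and_degree_eq_and_monic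
      (Polynomial.map_surjective _ Ideal.Quotient.mk_surjective f) hf
    refine ⟨⟨h, Polynomial.X * g, Polynomial.monic_X.mul hgm, ?_⟩, Subtype.ext ?_⟩
    · refine eq_zero_of_branchProj fun q => ?_
      rw [Polynomial.eval₂_mul, Polynomial.eval₂_X, map_mul, hh]
      by_cases hq : q = p
      · subst hq
        rw [Polynomial.hom_eval₂, hh, Function.update_self]
        have : (branchProj q).comp (algebraMap R (FractionRing R)) =
            (algebraMap (R ⧸ q.1) (FractionRing (R ⧸ q.1))).comp (Ideal.Quotient.mk q.1) :=
          RingHom.ext (branchProj_algebraMap q)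
        rw [this, ← Polynomial.eval₂_map, hg, hfa, mul_zero]
      · rw [Function.update_of_ne hq, zero_mul]
    · exact (hh p).trans (Function.update_self _ _ _)
  -- Residual rationality speaks of the integral closure of `R`, so the maximal ideal is pulled back
  -- there.
  set n := (maximalIdeal (normalization p)).comap φ with hn
  have hnmax : n.IsMaximal := Ideal.comap_isMaximal_of_surjective φ hφ
  obtain ⟨x, rfl⟩ := hφ a
  obtain ⟨r, hr⟩ := hR.residuallyRational n hnmax (Ideal.Quotient.mk n x)
  refine ⟨r, ?_⟩
  rw [RingHom.comp_apply, eq_comm, Ideal.Quotient.eq, hn, Ideal.mem_comap, map_sub,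
    IsLocalRing.mem_maximalIdeal] at hr
  have : φ (algebraMap R _ r) =
      algebraMap (R ⧸ p.1) (normalization p) (Ideal.Quotient.mk p.1 r) :=
    Subtype.ext (branchProj_algebraMap p r)
  rw [← this]
  exact hr

theorem not_isUnit_algebraMap {p : minimalPrimes R} {r : R} (hr : r ∈ maximalIdeal R) :
    ¬ IsUnit (algebraMap (R ⧸ p.1) (normalization p) (Ideal.Quotient.mk p.1 r)) := by
  intro h
  refine map_maximalIdeal_ne_top (D := R ⧸ p.1) (normalization p)
    (Ideal.eq_top_of_isUnit_mem _ (Ideal.mem_map_of_mem _ ?_) h)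
  rw [← map_maximalIdeal]
  exact Ideal.mem_map_of_mem _ hr

end IsCompleteAdmissible

/-! ### The value filtration of the total ring of fractions -/

/-- The submodule of the elements of the total ring of fractions whose value on the branch `p` is
at least `n`, with respect to a uniformizer `ϖ`. -/
def branchFiltration {R : Type u} [CommRing R] (p : minimalPrimes R) (ϖ : normalization p)
    (n : ℤ) : Submodule R (FractionRing R) where
  carrier := {h | branchProj p h ∈ zpowIdeal (FractionRing (R ⧸ p.1)) ϖ n}
  add_mem' := fun {a b} ha hb => by
    rw [Set.mem_ofPred_eq, map_add]
    exact Submodule.add_mem _ ha hb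
  zero_mem' := by
    rw [Set.mem_ofPred_eq, map_zero]
    exact Submodule.zero_mem _
  smul_mem' := fun r h hh => by
    rw [Set.mem_ofPred_eq, branchProj_smul]
    have hh' : branchProj p h ∈ zpowIdeal (FractionRing (R ⧸ p.1)) ϖ n := hh
    exact Submodule.smul_mem _ (algebraMap (R ⧸ p.1) (normalization p)
      (Ideal.Quotient.mk p.1 r)) hh'

theorem mem_branchFiltration {R : Type u} [CommRing R] {p : minimalPrimes R}
    {ϖ : normalization p} {n : ℤ} {h : FractionRing R} :
    h ∈ branchFiltration p ϖ n ↔ branchProj p h ∈ zpowIdeal (FractionRing (R ⧸ p.1)) ϖ n :=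
  Iff.rfl

theorem branchProj_ne_zero_of_notMem {R : Type u} [CommRing R] {p : minimalPrimes R}
    {ϖ : normalization p} {h : FractionRing R} {n : ℤ} (hh : h ∉ branchFiltration p ϖ n) :
    branchProj p h ≠ 0 := fun h0 => hh (by
  rw [mem_branchFiltration, h0]; exact Submodule.zero_mem _)

namespace IsCompleteAdmissible

variable {R : Type u} [CommRing R] [IsLocalRing R]

open IsLocalRing

theorem hasBranchValue_iff (hR : IsCompleteAdmissible R) {p : minimalPrimes R}
    {ϖ : normalization p} (hϖ : Irreducible ϖ) {h : FractionRing R} {n : ℤ} :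
    HasBranchValue p h n ↔ h ∈ branchFiltration p ϖ n ∧ h ∉ branchFiltration p ϖ (n + 1) := by
  have := hR.isDiscreteValuationRing p
  exact hasValue_iff hϖ

theorem exists_value_of_ne_zero (hR : IsCompleteAdmissible R) {p : minimalPrimes R}
    {ϖ : normalization p} (hϖ : Irreducible ϖ) {h : FractionRing R} (hh : branchProj p h ≠ 0) :
    ∃ n : ℤ, (h ∈ branchFiltration p ϖ n ∧ h ∉ branchFiltration p ϖ (n + 1)) ∧
      ∀ m x, h * x ∈ branchFiltration p ϖ (m + n) ↔ x ∈ branchFiltration p ϖ m := by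
  have := hR.isDiscreteValuationRing p
  obtain ⟨u, n, hn⟩ := exists_unit_mul_zpow hϖ hh
  refine ⟨n, ?_, fun m x => ?_⟩
  · rw [mem_branchFiltration, mem_branchFiltration, hn, mul_zpow_mem_succ_iff hϖ,
      dvd_iff_not_isUnit hϖ, not_not]
    exact ⟨mem_zpowIdeal.2 ⟨_, rfl⟩, u.isUnit⟩
  · rw [mem_branchFiltration, map_mul, hn, mul_mem_zpowIdeal_iff hϖ]
    rfl

theorem isValueFiltration (hR : IsCompleteAdmissible R) {ι : Type*} (p : ι ≃ minimalPrimes R)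
    (ϖ : ∀ i, normalization (p i)) (hϖ : ∀ i, Irreducible (ϖ i)) :
    IsValueFiltration (fun i => branchFiltration (p i) (ϖ i)) where
  antitone i m n hmn h hh := zpowIdeal_antitone (hϖ i) hmn hh
  exists_sub_smul_mem := by
    intro i n h hh h' hh' hn
    have := hR.isDiscreteValuationRing (p i)
    obtain ⟨a, ha⟩ := exists_sub_mul_mem_succ (hϖ i) (mem_branchFiltration.1 hh)
      (mem_branchFiltration.1 hh') hn
    obtain ⟨r, hr⟩ := hR.exists_sub_mem_maximalIdeal (p i) a
    refine ⟨r, ?_⟩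
    rw [mem_branchFiltration, map_sub, branchProj_smul]
    exact ha _ hr
  smul_mem_succ := by
    intro i n r hr h hh
    have := hR.isDiscreteValuationRing (p i)
    rw [mem_branchFiltration, branchProj_smul]
    exact nonunit_mul_mem_succ (hϖ i) (not_isUnit_algebraMap hr) hh
  exists_value := by
    intro α
    have := hR.isReduced
    have := hR.finite_minimalPrimes
    -- The uniformizer is transported along `p (p.symm q) = q`; `key` removes the transport.
    obtain ⟨h, hh⟩ := exists_branchProj_eq (R := R) fun q =>
      algebraMap (normalization q) _ (p.apply_symm_apply q ▸ ϖ (p.symm q)) ^ α (p.symm q)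
    refine ⟨h, fun i => ?_⟩
    have := hR.isDiscreteValuationRing (p i)
    have h1 : branchProj (p i) h = algebraMap (normalization (p i)) _ 1 *
        algebraMap (normalization (p i)) _ (ϖ i) ^ α i := by
      rw [hh, map_one, one_mul]
      have key : ∀ (j : ι) (e : p j = p i), j = i →
          algebraMap (normalization (p i)) (FractionRing (R ⧸ (p i).1)) (e ▸ ϖ j) ^ α j =
          algebraMap (normalization (p i)) _ (ϖ i) ^ α i := by
        rintro j e rfl
        rfl
      exact key _ _ (p.symm_apply_apply i)
    rw [mem_branchFiltration, mem_branchFiltration, h1, mul_zpow_mem_succ_iff (hϖ i),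
      dvd_iff_not_isUnit (hϖ i), not_not]
    exact ⟨mem_zpowIdeal.2 ⟨_, rfl⟩, isUnit_one⟩

/-- The conductor of `R` in its normalization. -/
theorem exists_conductor (hR : IsCompleteAdmissible R) {ι : Type*} (p : ι ≃ minimalPrimes R)
    (ϖ : ∀ i, normalization (p i)) (hϖ : ∀ i, Irreducible (ϖ i)) :
    ∃ γ : ι → ℤ, ∀ h, (∀ i, h ∈ branchFiltration (p i) (ϖ i) (γ i)) →
      ∃ r : R, algebraMap R (FractionRing R) r = h := by
  classical
  have := hR.isReduced
  have := hR.finite_minimalPrimes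
  cases nonempty_fintype (minimalPrimes R)
  choose c hc hc' using hR.exists_conductor_branch
  obtain ⟨s, hs, hs', hsb⟩ := exists_combination (R := R)
  set d := ∑ q, s q * c q with hd
  have hd0 : d ∈ R⁰ := hsb c hc
  have hmod : ∀ (b : minimalPrimes R → R) q, Ideal.Quotient.mk q.1 (∑ q, s q * b q) =
      Ideal.Quotient.mk q.1 (s q * b q) := by
    intro b q
    rw [Ideal.Quotient.eq, ← Finset.add_sum_erase _ _ (Finset.mem_univ q), add_sub_cancel_left]
    exact q.1.sum_mem fun q' hq => q.1.mul_mem_right _ (hs' q' q (Finset.ne_of_mem_erase hq).symm)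
  have hval : ∀ i, branchProj (p i) (algebraMap R (FractionRing R) d) ≠ 0 := fun i => by
    rw [Ne, branchProj_algebraMap_eq_zero]
    exact notMem_of_mem_nonZeroDivisors hd0
  -- `γ` is the value of `d`. Elements of value at least `γ` are thus `d * x` with `x` integral on
  -- every branch, and the branch denominators `c` carry `d * x` into `R`.
  choose γ hγ hγ' using fun i => hR.exists_value_of_ne_zero (hϖ i) (hval i)
  refine ⟨γ, fun h hh => ?_⟩
  obtain ⟨x, rfl⟩ : ∃ x, algebraMap R (FractionRing R) d * x = h := by
    obtain ⟨u, hu⟩ := IsLocalization.map_units (FractionRing R) (⟨d, hd0⟩ : R⁰)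
    exact ⟨(u⁻¹ : _ˣ) * h, by rw [← mul_assoc, ← hu, Units.mul_inv, one_mul]⟩
  have hx : ∀ q, ∃ r : R,
      algebraMap (R ⧸ q.1) (FractionRing (R ⧸ q.1)) (Ideal.Quotient.mk q.1 (c q)) *
        branchProj q x = algebraMap (R ⧸ q.1) (FractionRing (R ⧸ q.1))
          (Ideal.Quotient.mk q.1 r) := by
    intro q
    obtain ⟨i, rfl⟩ := p.surjective q
    have h1 := hh i
    rw [← zero_add (γ i), hγ', mem_branchFiltration, mem_zpowIdeal] at h1
    obtain ⟨a, ha⟩ := h1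
    rw [zpow_zero, mul_one] at ha
    rw [← ha]
    exact hc' (p i) a
  choose r hr using hx
  refine ⟨∑ q, s q * r q, eq_of_branchProj fun q => ?_⟩
  rw [map_mul, branchProj_algebraMap, branchProj_algebraMap, hmod, hmod, map_mul, map_mul, map_mul,
    map_mul, mul_assoc, hr]

/-- The lower bound is minus the value of a common denominator; the conductor is that of `R`,
shifted by the value of a regular element of `I`. -/
theorem exists_bounds (hR : IsCompleteAdmissible R) {ι : Type*} (p : ι ≃ minimalPrimes R)
    (ϖ : ∀ i, normalization (p i)) (hϖ : ∀ i, Irreducible (ϖ i))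
    {I : FractionalIdeal R⁰ (FractionRing R)} (hI : IsRegularIdeal I) :
    (∃ α : ι → ℤ, ∀ h ∈ (I : Submodule R (FractionRing R)), ∀ i,
      h ∈ branchFiltration (p i) (ϖ i) (α i)) ∧
    ∃ γ : ι → ℤ, ∀ h, (∀ i, h ∈ branchFiltration (p i) (ϖ i) (γ i)) →
      h ∈ (I : Submodule R (FractionRing R)) := by
  have hval : ∀ a ∈ R⁰, ∀ i, branchProj (p i) (algebraMap R (FractionRing R) a) ≠ 0 := by
    intro a ha i
    rw [Ne, branchProj_algebraMap_eq_zero]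
    exact notMem_of_mem_nonZeroDivisors ha
  constructor
  · obtain ⟨d, hd, hdI⟩ := I.isFractional
    choose n hn hn' using fun i => hR.exists_value_of_ne_zero (hϖ i) (hval d hd i)
    refine ⟨fun i => -n i, fun h hh i => ?_⟩
    rw [← hn' i, neg_add_cancel, mem_branchFiltration, mem_zpowIdeal]
    obtain ⟨r, hr⟩ := hdI h hh
    rw [Algebra.smul_def] at hr
    refine ⟨algebraMap (R ⧸ (p i).1) (normalization (p i)) (Ideal.Quotient.mk (p i).1 r), ?_⟩
    rw [zpow_zero, mul_one, ← hr, branchProj_algebraMap]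
    rfl
  · obtain ⟨a, ha, haI⟩ := hI
    choose n hn hn' using fun i => hR.exists_value_of_ne_zero (hϖ i) (hval a ha i)
    obtain ⟨γ, hγ⟩ := hR.exists_conductor p ϖ hϖ
    refine ⟨fun i => γ i + n i, fun h hh => ?_⟩
    obtain ⟨u, hu⟩ := IsLocalization.map_units (FractionRing R) (⟨a, ha⟩ : R⁰)
    obtain ⟨x, rfl⟩ : ∃ x, algebraMap R (FractionRing R) a * x = h :=
      ⟨(u⁻¹ : _ˣ) * h, by rw [← mul_assoc, ← hu, Units.mul_inv, one_mul]⟩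
    obtain ⟨r, rfl⟩ := hγ x fun i => (hn' i _ _).1 (hh i)
    rw [mul_comm, ← Algebra.smul_def]
    exact Submodule.smul_mem _ r haI

theorem valueSet_eq (hR : IsCompleteAdmissible R) {ι : Type*} (p : ι ≃ minimalPrimes R)
    (ϖ : ∀ i, normalization (p i)) (hϖ : ∀ i, Irreducible (ϖ i))
    (I : FractionalIdeal R⁰ (FractionRing R)) :
    valueSet p I = filtValues (fun i => branchFiltration (p i) (ϖ i)) I := by
  have := hR.isReduced
  have := hR.finite_minimalPrimes
  ext α
  constructor
  · rintro ⟨h, hh, -, hv⟩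
    exact ⟨h, hh, fun i => (hR.hasBranchValue_iff (hϖ i)).1 (hv i)⟩
  · rintro ⟨h, hh, hv⟩
    refine ⟨h, hh, mem_nonZeroDivisors_iff_branchProj.2 fun q => ?_,
      fun i => (hR.hasBranchValue_iff (hϖ i)).2 (hv i)⟩
    obtain ⟨i, rfl⟩ := p.surjective q
    exact branchProj_ne_zero_of_notMem (hv i).2

/-- An element regular on the branches in `J` may vanish on others; perturbing it gives finite
values there and keeps those in `J`. -/
theorem projValueSet_eq (hR : IsCompleteAdmissible R) {ι : Type*} (p : ι ≃ minimalPrimes R)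
    (ϖ : ∀ i, normalization (p i)) (hϖ : ∀ i, Irreducible (ϖ i))
    {I : FractionalIdeal R⁰ (FractionRing R)} (hI : IsRegularIdeal I) (J : Set ι) :
    projValueSet p I J = (fun (β : ι → ℤ) (k : J) => β k) ''
      filtValues (fun i => branchFiltration (p i) (ϖ i)) I := by
  have := hR.finite_minimalPrimes
  obtain ⟨⟨α, hα⟩, ⟨γ, hγ⟩⟩ := hR.exists_bounds p ϖ hϖ hI
  ext δ
  constructor
  · rintro ⟨h, hh, -, hv⟩
    obtain ⟨β, hβ, h1, -⟩ :=
      (hR.isValueFiltration p ϖ hϖ).exists_filtValues hα hγ hh (fun _ => 0)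
    refine ⟨β, hβ, funext fun j => ?_⟩
    have := (hR.hasBranchValue_iff (hϖ j)).1 (hv j)
    exact h1 j _ this.1 this.2
  · rintro ⟨β, ⟨h, hh, hv⟩, rfl⟩
    exact ⟨h, hh, (multiProj_mem_nonZeroDivisors_iff _ _).2 fun j _ =>
      branchProj_ne_zero_of_notMem (hv j).2, fun j => (hR.hasBranchValue_iff (hϖ j)).2 (hv j)⟩

theorem branchValueSet_eq (hR : IsCompleteAdmissible R) {ι : Type*} (p : ι ≃ minimalPrimes R)
    (ϖ : ∀ i, normalization (p i)) (hϖ : ∀ i, Irreducible (ϖ i))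
    {I : FractionalIdeal R⁰ (FractionRing R)} (hI : IsRegularIdeal I) (i : ι) :
    branchValueSet p I i =
      {n | ∃ β ∈ filtValues (fun i => branchFiltration (p i) (ϖ i)) I, β i = n} := by
  ext n
  rw [branchValueSet, Set.mem_ofPred_eq, hR.projValueSet_eq p ϖ hϖ hI]
  constructor
  · rintro ⟨β, hβ, h⟩
    exact ⟨β, hβ, congrFun h ⟨i, rfl⟩⟩
  · rintro ⟨β, hβ, h⟩
    refine ⟨β, hβ, funext ?_⟩
    rintro ⟨k, rfl⟩
    exact h

/-- Three minimal primes force a residue class other than 0 and 1. -/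
theorem exists_isUnit_one_sub (hR : IsCompleteAdmissible R) (p : Fin 3 ≃ minimalPrimes R) :
    ∃ u : R, IsUnit u ∧ IsUnit (1 - u) := by
  have h1 : (3 : ℕ∞) ≤ ENat.card (ResidueField R) := by
    refine le_trans (le_of_eq ?_) hR.card_residueField
    rw [Set.encard, ← ENat.card_congr p]
    simp
  obtain ⟨x, hx0, hx1⟩ : ∃ x : ResidueField R, x ≠ 0 ∧ x ≠ 1 := by
    by_contra! hc
    have h2 : (Set.univ : Set (ResidueField R)) ⊆ {0, 1} := fun x _ => by
      by_cases hx : x = 0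
      · exact Or.inl hx
      · exact Or.inr (hc x hx)
    have h3 := (Set.encard_le_encard h2).trans (Set.encard_insert_le _ _)
    rw [Set.encard_univ, Set.encard_singleton] at h3
    exact absurd (h1.trans h3) (by norm_num)
  obtain ⟨u, rfl⟩ := residue_surjective x
  refine ⟨u, ?_, ?_⟩
  · rwa [← residue_ne_zero_iff_isUnit]
  · rw [← residue_ne_zero_iff_isUnit, map_sub, map_one, sub_ne_zero]
    exact hx1.symm

end IsCompleteAdmissible
end AdmissibleRing

/-! ### The length formula -/

open AdmissibleRing in
theorem corollary19 {R : Type*} [CommRing R] [IsLocalRing R] (hR : IsCompleteAdmissible R)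
    (p : Fin 3 ≃ minimalPrimes R)
    (I J : FractionalIdeal R⁰ (FractionRing R))
    (hI : IsRegularIdeal I) (hJ : IsRegularIdeal J) (hJI : J ≤ I) :
    -- the sets that are counted are finite
    (∀ 𝔞 ∈ ({I, J} : Set (FractionalIdeal R⁰ (FractionRing R))),
      (∀ i, (gaps (branchValueSet p 𝔞 i)).Finite) ∧
      (∀ i j, i < j → (maximals (projValueSet p 𝔞 {i, j})).Finite) ∧
      (maximals (valueSet p 𝔞)).Finite) ∧
    ∃ α β : Fin 3 → ℤ, IsLeast (valueSet p I) α ∧ IsLeast (valueSet p J) β ∧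
      ∃ l : ℕ,
        Module.length R ((I : Submodule R (FractionRing R)) ⧸
          (J : Submodule R (FractionRing R)).submoduleOf (I : Submodule R (FractionRing R))) = l ∧
        (l : ℤ) =
          ∑ i, ((β i - α i) +
            (((gaps (branchValueSet p J i)).ncard : ℤ) - (gaps (branchValueSet p I i)).ncard)) +
          ∑ i, ∑ j ∈ Finset.Ioi i, ((maximals (projValueSet p J {i, j})).ncard : ℤ) -
          ∑ i, ∑ j ∈ Finset.Ioi i, ((maximals (projValueSet p I {i, j})).ncard : ℤ) +
          ((relMaximals (valueSet p J)).ncard : ℤ) - (relMaximals (valueSet p I)).ncard +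
          (absMaximals (valueSet p I)).ncard - (absMaximals (valueSet p J)).ncard := by
  have hdvr := fun i => hR.isDiscreteValuationRing (p i)
  choose ϖ hϖ using fun i => IsDiscreteValuationRing.exists_irreducible (normalization (p i))
  have hF := hR.isValueFiltration p ϖ hϖ
  have hu := hR.exists_isUnit_one_sub p
  obtain ⟨⟨α, hα⟩, -⟩ := hR.exists_bounds p ϖ hϖ hI
  obtain ⟨-, ⟨γ, hγJ⟩⟩ := hR.exists_bounds p ϖ hϖ hJ
  have hle : (J : Submodule R (FractionRing R)) ≤ (I : Submodule R (FractionRing R)) := hJI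
  -- A conductor of `J` also serves `I`, and a lower bound for `I` serves `J`, so both are measured
  -- against the same submodule.
  have hγI := fun h hh => hle (hγJ h hh)
  have hαJ := fun h (hh : h ∈ (J : Submodule R (FractionRing R))) => hα h (hle hh)
  have hEI := hF.isGoodSet hα hγI hu
  have hEJ := hF.isGoodSet hαJ hγJ hu
  obtain ⟨mI, hmI⟩ := hEI.exists_isLeast
  obtain ⟨mJ, hmJ⟩ := hEJ.exists_isLeast
  have hpI := fun i j (hij : i ≠ j) => hEI.maximals_proj hij (hR.projValueSet_eq p ϖ hϖ hI {i, j})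
  have hpJ := fun i j (hij : i ≠ j) => hEJ.maximals_proj hij (hR.projValueSet_eq p ϖ hϖ hJ {i, j})
  obtain ⟨lI, hlI, hcI⟩ := hF.relLength_conductor hα hγI hu hmI
  obtain ⟨lJ, hlJ, hcJ⟩ := hF.relLength_conductor hαJ hγJ hu hmJ
  refine ⟨?_, mI, mJ, ?_, ?_, ?_⟩
  · rintro 𝔞 (rfl | rfl)
    · refine ⟨fun i => ?_, fun i j hij => (hpI i j hij.ne).1, ?_⟩
      · rw [hR.branchValueSet_eq p ϖ hϖ hI]
        exact ((hEI.lower_of_isLeast hmI).gaps_proj hmI.1 i).1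
      · rw [hR.valueSet_eq p ϖ hϖ]
        exact hEI.maximals_finite
    · refine ⟨fun i => ?_, fun i j hij => (hpJ i j hij.ne).1, ?_⟩
      · rw [hR.branchValueSet_eq p ϖ hϖ hJ]
        exact ((hEJ.lower_of_isLeast hmJ).gaps_proj hmJ.1 i).1
      · rw [hR.valueSet_eq p ϖ hϖ]
        exact hEJ.maximals_finite
  · rwa [hR.valueSet_eq p ϖ hϖ]
  · rwa [hR.valueSet_eq p ϖ hϖ]
  -- Additivity along conductor, `J`, `I`; the length of `I / J` is finite because that of `I` over
  -- the conductor is.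
  · have hadd := relLength_add (fun h hh => hγJ h ((Submodule.mem_iInf _).1 hh)) hle
    rw [hlI, hlJ] at hadd
    obtain ⟨l, hl⟩ := ENat.ne_top_iff_exists.1 (ne_top_of_le_ne_top (ENat.natCast_ne_top lI)
      (hadd ▸ le_add_self))
    rw [← hl] at hadd
    have hadd' : lI = lJ + l := by exact_mod_cast hadd
    refine ⟨l, hl.symm, ?_⟩
    have hIoi : ∀ f : Fin 3 → Fin 3 → ℤ, ∑ i, ∑ j ∈ Finset.Ioi i, f i j =
        f 0 1 + f 0 2 + f 1 2 := by
      intro f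
      rw [Fin.sum_univ_three, show Finset.Ioi (0 : Fin 3) = {1, 2} by decide,
        show Finset.Ioi (1 : Fin 3) = {2} by decide, show Finset.Ioi (2 : Fin 3) = ∅ by decide]
      simp
    rw [hIoi, hIoi, (hpI 0 1 (by simp)).2, (hpI 0 2 (by simp)).2, (hpI 1 2 (by simp)).2,
      (hpJ 0 1 (by simp)).2, (hpJ 0 2 (by simp)).2, (hpJ 1 2 (by simp)).2,
      hR.valueSet_eq p ϖ hϖ, hR.valueSet_eq p ϖ hϖ]
    simp only [hR.branchValueSet_eq p ϖ hϖ hI, hR.branchValueSet_eq p ϖ hϖ hJ,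
      Finset.sum_add_distrib, Finset.sum_sub_distrib] at hcI hcJ ⊢
    omega
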